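/- **Lemma.** Let $(M,I,\langle\cdot,\cdot\rangle)$ be an almost Hermitian manifold of dimension $2n$, $n\ge 2$: a smooth manifold with a smooth Riemannian metric and a smooth almost complex structure $I$ that is orthogonal for the metric. Let $\nabla$ be the Levi-Civita connection and let $\widetilde\nabla=\nabla+\xi$ be the minimal $U(n)$-connection, i.e. the unique metric connection with $\widetilde\nabla I=0$ such that each $\xi_X=\widetilde\nabla_X-\nabla_X$ is orthogonal to $\mathfrak u(n)$ in $\mathfrak{so}(2n)$, where $\mathfrak u(n)$ consists of the skew-symmetric endomorphisms commuting with $I$. Put $(I\xi)_XY=I(\xi_XY)$, $R_{X,Y}=\nabla_{[X,Y]}-[\nabla_X,\nabla_Y]$ and $$\mathrm{Ric}(X,Y)=\langle R_{X,e_i}Y,e_i\rangle,\qquad \mathrm{Ric}^*(X,Y)=\langle R_{X,e_i}IY,Ie_i\rangle ,$$ where $e_1,\dots,e_{2n}$ is an orthonormal basis of the tangent space and, here and below, one sums over the repeated index $i$. For a bilinear form $b$ on a tangent space put $$b_H(X,Y)=\tfrac12\big(b(X,Y)+b(IX,IY)\big),\qquad b_{AH}(X,Y)=\tfrac12\big(b(X,Y)-b(IX,IY)\big).$$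 Then for all tangent vectors $X,Y$ at a point and every orthonormal basis $(e_i)$ of the tangent space at that point: (1) $$\begin{aligned} \mathrm{Ric}^*(X,Y)-\mathrm{Ric}(X,Y) &=2\langle(\nabla_{e_i}I\xi)_XIY,e_i\rangle-2\langle(\nabla_XI\xi)_{e_i}IY,e_i\rangle\\ &=2\langle(\widetilde\nabla_{e_i}\xi)_XY,e_i\rangle-2\langle(\widetilde\nabla_X\xi)_{e_i}Y,e_i\rangle +2\langle\xi_{\xi_{e_i}X}Y,e_i\rangle-2\langle\xi_{\xi_Xe_i}Y,e_i\rangle . \end{aligned}$$ (2) Consequently, $$\begin{aligned} (\mathrm{Ric}^*_H-\mathrm{Ric}_H)(X,Y) ={}&\langle(\widetilde\nabla_{e_i}\xi)_XY,e_i\rangle-\langle(\widetilde\nabla_X\xi)_{e_i}Y,e_i\rangle +\langle(\widetilde\nabla_{e_i}\xi)_{IX}IY,e_i\rangle-\langle(\widetilde\nabla_{IX}\xi)_{e_i}IY,e_i\rangle\\ &+\langle\xi_{\xi_{e_i}X}Y,e_i\rangle-\langle\xi_{\xi_Xe_i}Y,e_i\rangle +\langle\xi_{\xi_{e_i}IX}IY,e_i\rangle-\langle\xi_{\xi_{IX}e_i}IY,e_i\rangle,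 \end{aligned}$$ $$\begin{aligned} 2\,\mathrm{Ric}^*_{AH}(X,Y) ={}&\langle(\widetilde\nabla_{e_i}\xi)_XY,e_i\rangle-\langle(\widetilde\nabla_{e_i}\xi)_YX,e_i\rangle -\langle(\widetilde\nabla_{e_i}\xi)_{IX}IY,e_i\rangle+\langle(\widetilde\nabla_{e_i}\xi)_{IY}IX,e_i\rangle\\ &-\langle(\widetilde\nabla_X\xi)_{e_i}Y,e_i\rangle+\langle(\widetilde\nabla_Y\xi)_{e_i}X,e_i\rangle +\langle(\widetilde\nabla_{IX}\xi)_{e_i}IY,e_i\rangle-\langle(\widetilde\nabla_{IY}\xi)_{e_i}IX,e_i\rangle\\ &-\langle\xi_{\xi_Xe_i}Y,e_i\rangle+\langle\xi_{\xi_Ye_i}X,e_i\rangle +\langle\xi_{\xi_{IX}e_i}IY,e_i\rangle-\langle\xi_{\xi_{IY}e_i}IX,e_i\rangle, \end{aligned}$$ $$\begin{aligned} 2\,\mathrm{Ric}_{AH}(X,Y) ={}&-\langle(\widetilde\nabla_{e_i}\xi)_XY,e_i\rangle+\langle(\widetilde\nabla_X\xi)_{e_i}Y,e_i\rangle -\langle(\widetilde\nabla_{e_i}\xi)_YX,e_i\rangle+\langle(\widetilde\nabla_Y\xi)_{e_i}X,e_i\rangle\\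 &+\langle(\widetilde\nabla_{e_i}\xi)_{IX}IY,e_i\rangle-\langle(\widetilde\nabla_{IX}\xi)_{e_i}IY,e_i\rangle +\langle(\widetilde\nabla_{e_i}\xi)_{IY}IX,e_i\rangle-\langle(\widetilde\nabla_{IY}\xi)_{e_i}IX,e_i\rangle\\ &-\langle\xi_{\xi_{e_i}X}Y,e_i\rangle+\langle\xi_{\xi_Xe_i}Y,e_i\rangle -\langle\xi_{\xi_{e_i}Y}X,e_i\rangle+\langle\xi_{\xi_Ye_i}X,e_i\rangle\\ &+\langle\xi_{\xi_{e_i}IX}IY,e_i\rangle-\langle\xi_{\xi_{IX}e_i}IY,e_i\rangle +\langle\xi_{\xi_{e_i}IY}IX,e_i\rangle-\langle\xi_{\xi_{IY}e_i}IX,e_i\rangle . \end{aligned}$$ -/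

import Mathlib

open Bundle FiberBundle NormedSpace VectorField
open scoped Manifold ContDiff

noncomputable section

namespace AlmostHermitian

variable {E : Type*} [NormedAddCommGroup E] [NormedSpace ℝ E] [FiniteDimensional ℝ E]
  {H : Type*} [TopologicalSpace H] {I : ModelWithCorners ℝ E H}
  {M : Type*} [TopologicalSpace M] [ChartedSpace H M] [IsManifold I ∞ M]
  [RiemannianBundle (fun x : M ↦ TangentSpace I x)]
  [IsContMDiffRiemannianBundle I ∞ E (fun x : M ↦ TangentSpace I x)]

/-- The right hand side of Koszul's formula for `2 ⟨∇_X Y, Z⟩`. -/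
def koszul (X Y Z : Π x : M, TangentSpace I x) (x : M) : ℝ :=
  d% (fun y ↦ inner ℝ (Y y) (Z y)) x (X x) + d% (fun y ↦ inner ℝ (X y) (Z y)) x (Y x)
    - d% (fun y ↦ inner ℝ (X y) (Y y)) x (Z x)
    + inner ℝ (mlieBracket I X Y x) (Z x) - inner ℝ (mlieBracket I X Z x) (Y x)
    - inner ℝ (mlieBracket I Y Z x) (X x)


theorem inner_mdiff {X Y : Π x : M, TangentSpace I x} {x : M}
    (hX : MDiffAt (T% X) x) (hY : MDiffAt (T% Y) x) :
    MDiffAt (fun y ↦ (inner ℝ (X y) (Y y) : ℝ)) x := 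
  MDifferentiableAt.inner_bundle (E := fun x : M ↦ TangentSpace I x) (b := fun y : M ↦ y) (IB := I) (F := E) (v := X) (w := Y) hX hY

theorem koszul_tensorial_left {Y Z : Π x : M, TangentSpace I x} {x : M}
    (hY : MDiffAt (T% Y) x) (hZ : MDiffAt (T% Z) x) :
    TensorialAt I E (fun X ↦ koszul X Y Z x) x where
  smul {f X} hf hX := by
    have : CompleteSpace E := FiniteDimensional.complete ℝ E
    have hXZ := inner_mdiff hX hZ
    have hXY := inner_mdiff hX hY
    simp [koszul, mlieBracket_smul_left hf hX, inner_add_left, inner_smul_left, inner_smul_right,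
      mvfderiv_fun_mul hf hXZ, mvfderiv_fun_mul hf hXY]
    rw [real_inner_comm (Z x) (X x)]
    ring
  add {X X'} hX hX' := by
    have : CompleteSpace E := FiniteDimensional.complete ℝ E
    have hXZ := inner_mdiff hX hZ
    have hXY := inner_mdiff hX hY
    have hXZ' := inner_mdiff hX' hZ
    have hXY' := inner_mdiff hX' hY
    simp [koszul, mlieBracket_add_left hX hX', inner_add_left, inner_add_right,
      mvfderiv_fun_add hXZ hXZ', mvfderiv_fun_add hXY hXY']
    ring

theorem koszul_tensorial_right {X Y : Π x : M, TangentSpace I x} {x : M}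
    (hX : MDiffAt (T% X) x) (hY : MDiffAt (T% Y) x) :
    TensorialAt I E (fun Z ↦ koszul X Y Z x) x where
  smul {f Z} hf hZ := by
    have : CompleteSpace E := FiniteDimensional.complete ℝ E
    have hXZ := inner_mdiff hX hZ
    have hYZ := inner_mdiff hY hZ
    simp [koszul, mlieBracket_smul_right hf hZ, inner_add_left, inner_smul_left, inner_smul_right,
      mvfderiv_fun_mul hf hXZ, mvfderiv_fun_mul hf hYZ]
    rw [real_inner_comm (Y x) (Z x), real_inner_comm (X x) (Z x)]
    ring
  add {Z Z'} hZ hZ' := by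
    have : CompleteSpace E := FiniteDimensional.complete ℝ E
    have hXZ := inner_mdiff hX hZ
    have hYZ := inner_mdiff hY hZ
    have hXZ' := inner_mdiff hX hZ'
    have hYZ' := inner_mdiff hY hZ'
    simp [koszul, mlieBracket_add_right hZ hZ', inner_add_left, inner_add_right,
      mvfderiv_fun_add hXZ hXZ', mvfderiv_fun_add hYZ hYZ']
    ring


instance (x : M) : FiniteDimensional ℝ (TangentSpace I x) :=
  inferInstanceAs (FiniteDimensional ℝ E)

instance (x : M) : CompleteSpace (TangentSpace I x) := FiniteDimensional.complete ℝ _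


/-- For a fixed vector field `Y`, differentiable at `x`, the bilinear form
`(X, Z) ↦ koszul X Y Z x` on the tangent space at `x`. -/
def koszulForm (Y : Π x : M, TangentSpace I x) (x : M) (hY : MDiffAt (T% Y) x) :
    TangentSpace I x →L[ℝ] TangentSpace I x →L[ℝ] ℝ :=
  TensorialAt.mkHom₂ (I := I) (F := E) (F' := E) (fun X Z ↦ koszul X Y Z x) x
    (fun _ hZ ↦ koszul_tensorial_left hY hZ) (fun _ hX ↦ koszul_tensorial_right hX hY)

open scoped Classical in
/-- The Levi-Civita derivative of `Y` at `x`, given by Koszul's formula: the linear map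
`v ↦ ∇_v Y` with `⟨∇_v Y, w⟩ = ½ koszulForm Y x v w`. (Junk value `0` if `Y` is not
differentiable at `x`.) -/
def leviCivitaFun (Y : Π x : M, TangentSpace I x) (x : M) :
    TangentSpace I x →L[ℝ] TangentSpace I x :=
  if hY : MDiffAt (T% Y) x then
    LinearMap.toContinuousLinearMap
      { toFun := fun v ↦
          (2⁻¹ : ℝ) • (InnerProductSpace.toDual ℝ (TangentSpace I x)).symm (koszulForm Y x hY v)
        map_add' := by intro v w; simp
        map_smul' := by intro c v; simp [smul_comm c] }
  else 0

theorem inner_leviCivitaFun {X Y Z : Π x : M, TangentSpace I x} {x : M}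
    (hX : MDiffAt (T% X) x) (hY : MDiffAt (T% Y) x) (hZ : MDiffAt (T% Z) x) :
    inner ℝ (leviCivitaFun Y x (X x)) (Z x) = 2⁻¹ * koszul X Y Z x := by
  have h := TensorialAt.mkHom₂_apply (I := I) (F := E) (F' := E) (Φ := fun X Z ↦ koszul X Y Z x)
    (fun _ hZ ↦ koszul_tensorial_left hY hZ) (fun _ hX ↦ koszul_tensorial_right hX hY) hX hZ
  have h' : koszulForm Y x hY (X x) (Z x) = koszul X Y Z x := h
  simp only [leviCivitaFun, hY, dif_pos]
  simp [inner_smul_left, h']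

theorem ext_extend {x : M} {A B : TangentSpace I x →L[ℝ] TangentSpace I x}
    (h : ∀ X Z : Π x : M, TangentSpace I x, MDiffAt (T% X) x → MDiffAt (T% Z) x →
      (inner ℝ (A (X x)) (Z x) : ℝ) = inner ℝ (B (X x)) (Z x)) : A = B := by
  ext v
  refine ext_inner_right ℝ fun w ↦ ?_
  simpa using h (extend E v) (extend E w) (mdifferentiableAt_extend ..)
    (mdifferentiableAt_extend ..)

variable (I M) in
/-- The Levi-Civita connection `∇` of the Riemannian manifold `M`. As everywhere for Mathlib's
`CovariantDerivative`, `∇ Y x v` is `(∇_v Y)(x)`. -/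
def leviCivita : CovariantDerivative I E (fun x : M ↦ TangentSpace I x) where
  toFun := leviCivitaFun
  isCovariantDerivativeOnUniv :=
    { add := by
        intro Y Y' x hY hY' _
        have : CompleteSpace E := FiniteDimensional.complete ℝ E
        refine ext_extend fun X Z hX hZ ↦ ?_
        have hXY := inner_mdiff hX hY
        have hXY' := inner_mdiff hX hY'
        have hYZ := inner_mdiff hY hZ
        have hYZ' := inner_mdiff hY' hZ
        rw [inner_leviCivitaFun hX (mdifferentiableAt_add_section hY hY') hZ, add_apply, inner_add_left,
          inner_leviCivitaFun hX hY hZ, inner_leviCivitaFun hX hY' hZ]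
        simp [koszul, mlieBracket_add_left hY hY', mlieBracket_add_right hY hY', inner_add_left,
          inner_add_right, mvfderiv_fun_add hXY hXY', mvfderiv_fun_add hYZ hYZ']
        ring
      leibniz := by
        intro Y f x hY hf _
        have : CompleteSpace E := FiniteDimensional.complete ℝ E
        refine ext_extend fun X Z hX hZ ↦ ?_
        have hXY := inner_mdiff hX hY
        have hYZ := inner_mdiff hY hZ
        rw [inner_leviCivitaFun hX (hf.smul_section hY) hZ]
        simp [inner_add_left, inner_smul_left, inner_leviCivitaFun hX hY hZ]
        simp [koszul, mlieBracket_smul_left hf hY, mlieBracket_smul_right hf hY, inner_add_left,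
          inner_smul_left, inner_smul_right, mvfderiv_fun_mul hf hXY, mvfderiv_fun_mul hf hYZ]
        rw [real_inner_comm (X x) (Y x)]
        ring }


theorem inner_leviCivita {X Y Z : Π x : M, TangentSpace I x} {x : M}
    (hX : MDiffAt (T% X) x) (hY : MDiffAt (T% Y) x) (hZ : MDiffAt (T% Z) x) :
    inner ℝ (leviCivita I M Y x (X x)) (Z x) = 2⁻¹ * koszul X Y Z x :=
  inner_leviCivitaFun hX hY hZ

/-- The Levi-Civita connection is torsion free. -/
theorem leviCivita_torsion : (leviCivita I M).torsion = 0 := by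
  have : CompleteSpace E := FiniteDimensional.complete ℝ E
  rw [CovariantDerivative.torsion_eq_zero_iff]
  intro X Y x hX hY
  refine ext_inner_right ℝ fun w ↦ ?_
  have hZ : MDiffAt (T% (extend E w)) x := mdifferentiableAt_extend ..
  have h1 := inner_leviCivita hX hY hZ
  have h2 := inner_leviCivita hY hX hZ
  simp only [extend_apply_self] at h1 h2
  rw [inner_sub_left, h1, h2, koszul, koszul, mlieBracket_swap (V := Y) (W := X)]
  have h3 : (fun y ↦ (inner ℝ (Y y) (X y) : ℝ)) = fun y ↦ inner ℝ (X y) (Y y) := by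
    ext y; exact real_inner_comm _ _
  rw [h3]
  simp
  ring

/-- The Levi-Civita connection is a metric connection. -/
theorem leviCivita_isMetricCompatible :
    (leviCivita I M).IsMetricCompatible (V := fun x : M ↦ TangentSpace I x) := by
  have : CompleteSpace E := FiniteDimensional.complete ℝ E
  rw [CovariantDerivative.isMetricCompatible_iff]
  intro x X Y Z hX hY hZ
  have h1 := inner_leviCivita hX hY hZ
  have h2 := inner_leviCivita hX hZ hY
  rw [real_inner_comm] at h2
  beta_reduce
  rw [h1, h2, koszul, koszul, mlieBracket_swap (V := Z) (W := Y)]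
  have h3 : (fun y ↦ (inner ℝ (Z y) (Y y) : ℝ)) = fun y ↦ inner ℝ (Y y) (Z y) := by
    ext y; exact real_inner_comm _ _
  rw [h3]
  simp
  ring


variable (I M) in
/-- A smooth almost complex structure on `M` which is orthogonal for the Riemannian metric, i.e. the
datum which turns the Riemannian manifold `M` into an almost Hermitian manifold. -/
structure OrthogonalAlmostComplexStructure where
  toFun : Π x : M, TangentSpace I x →L[ℝ] TangentSpace I x
  contMDiff_toFun : ContMDiff I (I.prod 𝓘(ℝ, E →L[ℝ] E)) ∞
    (fun x ↦ TotalSpace.mk' (E →L[ℝ] E)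
      (E := fun x : M ↦ TangentSpace I x →L[ℝ] TangentSpace I x) x (toFun x))
  sq : ∀ (x : M) (v : TangentSpace I x), toFun x (toFun x v) = -v
  orthogonal : ∀ (x : M) (v w : TangentSpace I x),
    (inner ℝ (toFun x v) (toFun x w) : ℝ) = inner ℝ v w

instance : CoeFun (OrthogonalAlmostComplexStructure I M)
    (fun _ ↦ Π x : M, TangentSpace I x →L[ℝ] TangentSpace I x) :=
  ⟨OrthogonalAlmostComplexStructure.toFun⟩

variable (J : OrthogonalAlmostComplexStructure I M)

/-- `D` is the minimal `U(n)`-connection of the almost Hermitian manifold: a metric connection for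
which the almost complex structure is parallel (i.e. a `U(n)`-connection), and such that, for every
tangent vector `X`, the endomorphism `ξ_X = D_X - ∇_X` is orthogonal to the Lie algebra `𝔲(n)` of
all skew-symmetric endomorphisms `A` which commute with the almost complex structure. (The
endomorphism `ξ_X` is itself skew-symmetric, because `D` and `∇` are both metric.)
Mathlib's `D.difference ∇ x Y X` is `D_X Y - ∇_X Y = ξ_X Y`. -/
structure IsMinimalUnitaryConnection
    (D : CovariantDerivative I E (fun x : M ↦ TangentSpace I x)) : Prop where
  metric : D.IsMetricCompatible (V := fun x : M ↦ TangentSpace I x)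
  parallel : ∀ (Y : Π x : M, TangentSpace I x) (x : M), MDiffAt (T% Y) x →
    ∀ v : TangentSpace I x, D (fun y ↦ J y (Y y)) x v = J x (D Y x v)
  orthogonal : ∀ (x : M) (X : TangentSpace I x) (A : TangentSpace I x →ₗ[ℝ] TangentSpace I x),
    (∀ v w, (inner ℝ (A v) w : ℝ) = - inner ℝ v (A w)) → (∀ v, A (J x v) = J x (A v)) →
    ∑ i, (inner ℝ (D.difference (leviCivita I M) x (stdOrthonormalBasis ℝ (TangentSpace I x) i) X)
      (A (stdOrthonormalBasis ℝ (TangentSpace I x) i)) : ℝ) = 0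

theorem mdiff_J {Y : Π x : M, TangentSpace I x} {x : M} (hY : MDiffAt (T% Y) x) :
    MDiffAt (T% (fun y ↦ J y (Y y))) x :=
  MDifferentiableAt.clm_bundle_apply (𝕜 := ℝ) (F₁ := E) (F₂ := E) (b := fun y : M ↦ y)
    (E₁ := fun x : M ↦ TangentSpace I x) (E₂ := fun x : M ↦ TangentSpace I x)
    (J.contMDiff_toFun.mdifferentiableAt (by simp)) hY

theorem covDerivJ_tensorial (D : CovariantDerivative I E (fun x : M ↦ TangentSpace I x)) (x : M) :
    TensorialAt I E (fun Y : Π x : M, TangentSpace I x ↦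
      D (fun y ↦ J y (Y y)) x - J x ∘L D Y x) x where
  smul {f Y} hf hY := by
    have h : (fun y ↦ J y ((f • Y) y)) = f • fun y ↦ J y (Y y) := by ext y; simp
    rw [h, D.isCovariantDerivativeOn.leibniz (mdiff_J J hY) hf,
      D.isCovariantDerivativeOn.leibniz hY hf]
    ext v
    simp
    module
  add {Y Y'} hY hY' := by
    have h : (fun y ↦ J y ((Y + Y') y)) = (fun y ↦ J y (Y y)) + fun y ↦ J y (Y' y) := by
      ext y; simp
    rw [h, D.isCovariantDerivativeOn.add (mdiff_J J hY) (mdiff_J J hY'),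
      D.isCovariantDerivativeOn.add hY hY']
    ext v
    simp
    module

/-- `covDerivJ J D x Y X = (D_X J) Y` -/
def covDerivJ (D : CovariantDerivative I E (fun x : M ↦ TangentSpace I x)) (x : M) :
    TangentSpace I x →L[ℝ] TangentSpace I x →L[ℝ] TangentSpace I x :=
  TensorialAt.mkHom _ x (covDerivJ_tensorial J D x)

theorem covDerivJ_apply (D : CovariantDerivative I E (fun x : M ↦ TangentSpace I x)) {x : M}
    {Y : Π x : M, TangentSpace I x} (hY : MDiffAt (T% Y) x) (v : TangentSpace I x) :
    covDerivJ J D x (Y x) v = D (fun y ↦ J y (Y y)) x v - J x (D Y x v) := by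
  have := TensorialAt.mkHom_apply (covDerivJ_tensorial J D x) hY
  exact congr($this v)

theorem inner_J (x : M) (v w : TangentSpace I x) :
    (inner ℝ (J x v) w : ℝ) = - inner ℝ v (J x w) := by
  rw [← J.orthogonal x v (J x w), J.sq, inner_neg_right, neg_neg]

theorem covDerivJ_comp (D : CovariantDerivative I E (fun x : M ↦ TangentSpace I x)) {x : M}
    (w v : TangentSpace I x) :
    covDerivJ J D x (J x w) v = - J x (covDerivJ J D x w v) := by
  have hY : MDiffAt (T% (extend E w)) x := mdifferentiableAt_extend ..
  have h1 := covDerivJ_apply J D hY v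
  have h2 := covDerivJ_apply J D (mdiff_J J hY) v
  have h3 : (fun y ↦ J y (J y (extend E w y))) = (-1 : ℝ) • (extend E w : Π x : M, TangentSpace I x) := by
    ext y; simp [J.sq]
  rw [h3, D.isCovariantDerivativeOn.smul_const _ hY] at h2
  simp only [extend_apply_self] at h1 h2
  rw [h1, h2]
  simp [J.sq]
  abel

theorem covDerivJ_skew {D : CovariantDerivative I E (fun x : M ↦ TangentSpace I x)}
    (hD : D.IsMetricCompatible (V := fun x : M ↦ TangentSpace I x)) {x : M}
    (u w v : TangentSpace I x) :
    (inner ℝ (covDerivJ J D x u v) w : ℝ) = - inner ℝ u (covDerivJ J D x w v) := by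
  have hU : MDiffAt (T% (extend E u)) x := mdifferentiableAt_extend ..
  have hW : MDiffAt (T% (extend E w)) x := mdifferentiableAt_extend ..
  have h1 := covDerivJ_apply J D hU v
  have h2 := covDerivJ_apply J D hW v
  have h3 := hD.mvfderiv_inner_eq (extend E v) (mdiff_J J hU) hW
  have h4 := hD.mvfderiv_inner_eq (extend E v) hU (mdiff_J J hW)
  have h5 : (fun y ↦ (inner ℝ (J y (extend E u y)) (extend E w y) : ℝ))
      = fun y ↦ - inner ℝ (extend E u y) (J y (extend E w y)) := by
    ext y; exact inner_J J y _ _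
  rw [h5, mvfderiv_fun_neg] at h3
  simp only [extend_apply_self] at h1 h2 h3 h4
  simp only [neg_apply] at h3
  rw [h4] at h3
  rw [h1, h2, inner_sub_left, inner_sub_right, inner_J J x _ w]
  rw [inner_J J x u] at h3
  linarith

/-- `minimalForm J x Y X = -½ J (∇_X J) Y`. -/
def minimalForm (x : M) : TangentSpace I x →L[ℝ] TangentSpace I x →L[ℝ] TangentSpace I x :=
  (-2⁻¹ : ℝ) • (ContinuousLinearMap.compL ℝ _ _ _ (J x)) ∘L covDerivJ J (leviCivita I M) x


theorem minimalForm_apply (x : M) (Y X : TangentSpace I x) :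
    minimalForm J x Y X = (-2⁻¹ : ℝ) • J x (covDerivJ J (leviCivita I M) x Y X) := by
  simp [minimalForm]

theorem minimalForm_J (x : M) (Y X : TangentSpace I x) :
    minimalForm J x (J x Y) X = - J x (minimalForm J x Y X) := by
  simp [minimalForm_apply, covDerivJ_comp]

theorem minimalForm_skew (x : M) (Y Z X : TangentSpace I x) :
    (inner ℝ (minimalForm J x Y X) Z : ℝ) = - inner ℝ Y (minimalForm J x Z X) := by
  rw [minimalForm_apply, minimalForm_apply, inner_smul_left, inner_smul_right, inner_J J,
    covDerivJ_skew J leviCivita_isMetricCompatible, covDerivJ_comp]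
  simp

theorem difference_apply (D D' : CovariantDerivative I E (fun x : M ↦ TangentSpace I x)) {x : M}
    {Y : Π x : M, TangentSpace I x} (hY : MDiffAt (T% Y) x) (v : TangentSpace I x) :
    D.difference D' x (Y x) v = D Y x v - D' Y x v := by
  have := IsCovariantDerivativeOn.difference_apply D.isCovariantDerivativeOnUniv
    D'.isCovariantDerivativeOnUniv (x := x) (Set.mem_univ x) hY
  exact congr($this v)

/-- The minimal `U(n)`-connection exists. -/
theorem exists_isMinimalUnitaryConnection :
    ∃ D : CovariantDerivative I E (fun x : M ↦ TangentSpace I x),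
      IsMinimalUnitaryConnection J D := by
  refine ⟨(leviCivita I M).addOneForm (minimalForm J), ?_, ?_, ?_⟩
  · rw [CovariantDerivative.isMetricCompatible_iff]
    intro x X Y Z _ hY hZ
    have h := (leviCivita_isMetricCompatible (I := I) (M := M)).mvfderiv_inner_eq X hY hZ
    have h' := minimalForm_skew J x (Y x) (Z x) (X x)
    simp only [CovariantDerivative.addOneForm, add_apply, inner_add_left, inner_add_right] at h ⊢
    linarith
  · intro Y x hY v
    have h := covDerivJ_apply J (leviCivita I M) hY v
    have h' : (leviCivita I M) (fun y ↦ J y (Y y)) x v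
        = covDerivJ J (leviCivita I M) x (Y x) v + J x ((leviCivita I M) Y x v) := by
      rw [h]; abel
    simp only [CovariantDerivative.addOneForm, add_apply, map_add, minimalForm_J, h']
    simp only [minimalForm_apply, map_smul, J.sq]
    module
  · intro x X A hA hAJ
    set b := stdOrthonormalBasis ℝ (TangentSpace I x)
    have hdiff : ∀ w, ((leviCivita I M).addOneForm (minimalForm J)).difference (leviCivita I M) x w X
        = minimalForm J x w X := by
      intro w
      have hW : MDiffAt (T% (extend E w)) x := mdifferentiableAt_extend ..
      have := difference_apply ((leviCivita I M).addOneForm (minimalForm J)) (leviCivita I M) hW X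
      simpa [CovariantDerivative.addOneForm] using this
    let S : TangentSpace I x →ₗ[ℝ] TangentSpace I x :=
      { toFun := fun w ↦ minimalForm J x w X
        map_add' := by intro v w; simp
        map_smul' := by intro c v; simp }
    let K : TangentSpace I x →ₗ[ℝ] TangentSpace I x := (J x : TangentSpace I x →ₗ[ℝ] TangentSpace I x)
    have h1 : ∑ i, (inner ℝ (minimalForm J x (b i) X) (A (b i)) : ℝ)
        = - LinearMap.trace ℝ _ (A * S) := by
      rw [LinearMap.trace_eq_sum_inner _ b, ← Finset.sum_neg_distrib]
      refine Finset.sum_congr rfl fun i _ ↦ ?_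
      have h := hA (minimalForm J x (b i) X) (b i)
      have h' := real_inner_comm (b i) (A (minimalForm J x (b i) X))
      have h'' : (A * S) (b i) = A (minimalForm J x (b i) X) := rfl
      rw [h'']
      linarith
    have hKSK : K * S * K = S := by
      ext w
      simp [K, S, minimalForm_J, J.sq]
    have hKK : K * K = -1 := by
      ext w
      simp [K, J.sq]
    have hAK : A * K = K * A := by
      ext w
      simp [K, hAJ]
    have h2 : LinearMap.trace ℝ _ (A * S) = - LinearMap.trace ℝ _ (A * S) := by
      conv_lhs => rw [← hKSK, ← mul_assoc, LinearMap.trace_mul_comm, ← mul_assoc, ← mul_assoc, ← hAK,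
        mul_assoc A, hKK]
      simp
    simp only [hdiff]
    rw [h1]
    linarith

variable {J} in
/-- The minimal `U(n)`-connection is unique. -/
theorem IsMinimalUnitaryConnection.unique
    {D D' : CovariantDerivative I E (fun x : M ↦ TangentSpace I x)}
    (hD : IsMinimalUnitaryConnection J D) (hD' : IsMinimalUnitaryConnection J D')
    {Y : Π x : M, TangentSpace I x} {x : M} (hY : MDiffAt (T% Y) x) :
    D Y x = D' Y x := by
  ext v
  set b := stdOrthonormalBasis ℝ (TangentSpace I x)
  let B : TangentSpace I x →ₗ[ℝ] TangentSpace I x :=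
    { toFun := fun w ↦ D.difference (leviCivita I M) x w v - D'.difference (leviCivita I M) x w v
      map_add' := by intro v w; simp; abel
      map_smul' := by intro c v; simp [smul_sub] }
  have hB {Z : Π x : M, TangentSpace I x} (hZ : MDiffAt (T% Z) x) :
      B (Z x) = D Z x v - D' Z x v := by
    simp [B, difference_apply _ _ hZ]
  have hskew : ∀ u w, (inner ℝ (B u) w : ℝ) = - inner ℝ u (B w) := by
    intro u w
    have hU : MDiffAt (T% (extend E u)) x := mdifferentiableAt_extend ..
    have hW : MDiffAt (T% (extend E w)) x := mdifferentiableAt_extend ..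
    have h1 := hD.metric.mvfderiv_inner_eq (extend E v) hU hW
    have h2 := hD'.metric.mvfderiv_inner_eq (extend E v) hU hW
    have h3 := hB hU
    have h4 := hB hW
    simp only [extend_apply_self] at h1 h2 h3 h4
    rw [h3, h4, inner_sub_left, inner_sub_right]
    linarith
  have hcomm : ∀ w, B (J x w) = J x (B w) := by
    intro w
    have hW : MDiffAt (T% (extend E w)) x := mdifferentiableAt_extend ..
    have h3 := hB hW
    have h4 := hB (mdiff_J J hW)
    simp only [extend_apply_self] at h3 h4
    rw [h3, h4, hD.parallel _ x hW, hD'.parallel _ x hW, map_sub]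
  have h0 : ∑ i, ‖B (b i)‖ ^ 2 = 0 := by
    have h1 := hD.orthogonal x v B hskew hcomm
    have h2 := hD'.orthogonal x v B hskew hcomm
    rw [← sub_eq_zero.mpr (h1.trans h2.symm), ← Finset.sum_sub_distrib]
    refine Finset.sum_congr rfl fun i _ ↦ ?_
    rw [← inner_sub_left, ← real_inner_self_eq_norm_sq]
    rfl
  have hB0 : B = 0 := by
    refine b.toBasis.ext fun i ↦ ?_
    have := (Finset.sum_eq_zero_iff_of_nonneg (fun i _ ↦ sq_nonneg ‖B (b i)‖)).1 h0 i
      (Finset.mem_univ i)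
    simpa using this
  have := hB hY
  rw [hB0] at this
  exact (sub_eq_zero.1 (by simpa using this.symm))

/-- The minimal `U(n)`-connection `∇̃` of the almost Hermitian manifold. -/
def minimalUnitaryConnection : CovariantDerivative I E (fun x : M ↦ TangentSpace I x) :=
  Classical.choose (exists_isMinimalUnitaryConnection J)

theorem isMinimalUnitaryConnection_minimalUnitaryConnection :
    IsMinimalUnitaryConnection J (minimalUnitaryConnection J) :=
  Classical.choose_spec (exists_isMinimalUnitaryConnection J)

/-- The intrinsic torsion `ξ = ∇̃ - ∇` of the almost Hermitian manifold:
`intrinsicTorsion J x X Y = ξ_X Y`. -/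
def intrinsicTorsion (x : M) (X Y : TangentSpace I x) : TangentSpace I x :=
  (minimalUnitaryConnection J).difference (leviCivita I M) x Y X

/-- The tensor `Jξ`, i.e. `(Jξ)_X Y = J (ξ_X Y)`. -/
def complexIntrinsicTorsion (x : M) (X Y : TangentSpace I x) : TangentSpace I x :=
  J x (intrinsicTorsion J x X Y)

/-- The covariant derivative of a tensor field `B` of type `(1, 2)`, written `(X, Y) ↦ B_X Y`, with
respect to the connection `D`:
`(D_v B)_a b = D_v (B_A C) - B_{D_v A} b - B_a (D_v C)`,
where `A` and `C` are any differentiable vector fields with `A x = a` and `C x = b`. The value does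
not depend on the extensions, so Mathlib's `FiberBundle.extend` is used. -/
def covDerivTensor (D : CovariantDerivative I E (fun x : M ↦ TangentSpace I x))
    (B : Π x : M, TangentSpace I x → TangentSpace I x → TangentSpace I x) (x : M)
    (v a b : TangentSpace I x) : TangentSpace I x :=
  D (fun y ↦ B y (extend E a y) (extend E b y)) x v
    - B x (D (extend E a) x v) b - B x a (D (extend E b) x v)

/-- The Riemannian curvature tensor with the sign convention
`R_{U,V} = ∇_{[U,V]} - (∇_U ∇_V - ∇_V ∇_U)`, so that `curvature x u v w = R_{u,v} w`. The value at
`x` depends only on the values at `x` of the vector fields `U`, `V`, `W`, so it may be computed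
from the extensions `FiberBundle.extend` of `u`, `v`, `w`. -/
def curvature (x : M) (u v w : TangentSpace I x) : TangentSpace I x :=
  let U : Π y : M, TangentSpace I y := extend E u
  let V : Π y : M, TangentSpace I y := extend E v
  let W : Π y : M, TangentSpace I y := extend E w
  leviCivita I M W x (mlieBracket I U V x)
    - (leviCivita I M (fun y ↦ leviCivita I M W y (V y)) x (U x)
      - leviCivita I M (fun y ↦ leviCivita I M W y (U y)) x (V x))

/-- The Ricci curvature `Ric(X, Y) = ∑ i, ⟨R_{X,e_i} Y, e_i⟩`, where `e_i` is an orthonormal basis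
of the tangent space. -/
def ricci (x : M) (X Y : TangentSpace I x) : ℝ :=
  ∑ i, inner ℝ (curvature x X (stdOrthonormalBasis ℝ (TangentSpace I x) i) Y)
    (stdOrthonormalBasis ℝ (TangentSpace I x) i)

/-- The `*`-Ricci curvature `Ric*(X, Y) = ∑ i, ⟨R_{X,e_i} JY, J e_i⟩`, where `e_i` is an
orthonormal basis of the tangent space. -/
def ricciStar (x : M) (X Y : TangentSpace I x) : ℝ :=
  ∑ i, inner ℝ (curvature x X (stdOrthonormalBasis ℝ (TangentSpace I x) i) (J x Y))
    (J x (stdOrthonormalBasis ℝ (TangentSpace I x) i))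

/-- The Hermitian part `b_H` of a bilinear form `b` on the tangent space at `x`, i.e. its component
with `b_H(JX, JY) = b_H(X, Y)`. -/
def hermitianPart {x : M} (b : TangentSpace I x → TangentSpace I x → ℝ)
    (X Y : TangentSpace I x) : ℝ :=
  (b X Y + b (J x X) (J x Y)) / 2

/-- The anti-Hermitian part `b_AH` of a bilinear form `b` on the tangent space at `x`, i.e. its
component with `b_AH(JX, JY) = -b_AH(X, Y)`. -/
def antiHermitianPart {x : M} (b : TangentSpace I x → TangentSpace I x → ℝ)
    (X Y : TangentSpace I x) : ℝ :=
  (b X Y - b (J x X) (J x Y)) / 2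

end AlmostHermitian

end

/-! The intrinsic torsion `ξ_X` is skew-symmetric and, being orthogonal to `𝔲(n)`, anticommutes
with `J`; hence `∇̃J = 0` for `∇̃ = ∇ + ξ` says that `∇J = 2Jξ`. By the Ricci identity the
antisymmetrised second derivative of `J`, i.e. `2((∇_V Jξ)_X - (∇_X Jξ)_V)`, is the commutator
`[R_{X,V}, J]`, and the trace of this identity is the formula for `Ric* - Ric` through `∇`.
Replacing `∇` by `∇̃ - ξ` turns it into the formula through `∇̃`. For the anti-Hermitian parts,
`Ric` is symmetric, whereas the pair symmetry of `R` gives `Ric*(JX, JY) = Ric*(Y, X)`, so that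
`Ric*_AH` is skew: it is the skew part of `(Ric* - Ric)_AH`, and `-Ric_AH` is the symmetric part. -/

noncomputable section

namespace AlmostHermitian

open Filter Topology

theorem pair_symm_of_cyclic {α R : Type*} [AddCommGroup R] [IsAddTorsionFree R]
    {r : α → α → α → α → R} (swap : ∀ a b c d, r b a c d = -r a b c d)
    (skew : ∀ a b c d, r a b d c = -r a b c d)
    (cyclic : ∀ a b c d, r a b c d + r b c a d + r c a b d = 0) (a b c d : α) :
    r a b c d = r c d a b := by
  refine nsmul_right_injective two_ne_zero ?_
  linear_combination (norm := skip) cyclic a b c d + cyclic b c d a - cyclic c d a b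
  grind

section SkewEndomorphisms

variable {ι : Type*} [Fintype ι] {V : Type*} [NormedAddCommGroup V] [InnerProductSpace ℝ V]
  {A j ξ : Module.End ℝ V}

theorem sum_inner_apply_eq_trace (e : OrthonormalBasis ι ℝ V) (A : Module.End ℝ V) :
    ∑ i, (inner ℝ (A (e i)) (e i) : ℝ) = LinearMap.trace ℝ V A := by
  simp only [A.trace_eq_sum_inner e, real_inner_comm]

theorem sum_inner_apply_eq_neg_trace_mul (e : OrthonormalBasis ι ℝ V)
    (hA : ∀ v w, (inner ℝ (A v) w : ℝ) = -inner ℝ v (A w)) (B : Module.End ℝ V) :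
    ∑ i, (inner ℝ (B (e i)) (A (e i)) : ℝ) = -LinearMap.trace ℝ V (A * B) := by
  simp only [← sum_inner_apply_eq_trace e, Module.End.mul_apply, hA, Finset.sum_neg_distrib,
    neg_neg]

variable [FiniteDimensional ℝ V]

theorem eq_zero_of_trace_mul_self_eq_zero
    (hA : ∀ v w, (inner ℝ (A v) w : ℝ) = -inner ℝ v (A w))
    (h : LinearMap.trace ℝ V (A * A) = 0) : A = 0 := by
  let e := stdOrthonormalBasis ℝ V
  have hsum := sum_inner_apply_eq_neg_trace_mul e hA A
  simp only [h, neg_zero, real_inner_self_eq_norm_sq] at hsum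
  refine e.toBasis.ext fun i ↦ ?_
  simpa using (Finset.sum_eq_zero_iff_of_nonneg fun i _ ↦ sq_nonneg ‖A (e i)‖).1 hsum i
    (Finset.mem_univ i)

theorem mul_eq_neg_mul_of_trace_eq_zero (hj : ∀ v w, (inner ℝ (j v) w : ℝ) = -inner ℝ v (j w))
    (hjj : j * j = -1) (hξ : ∀ v w, (inner ℝ (ξ v) w : ℝ) = -inner ℝ v (ξ w))
    (h : ∀ A : Module.End ℝ V, (∀ v w, (inner ℝ (A v) w : ℝ) = -inner ℝ v (A w)) →
      A * j = j * A → LinearMap.trace ℝ V (A * ξ) = 0) :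
    ξ * j = -(j * ξ) := by
  -- Twice the component of `ξ` which commutes with `j`.
  let A := ξ - j * ξ * j
  have hA (v w : V) : (inner ℝ (A v) w : ℝ) = -inner ℝ v (A w) := by
    simp only [A, LinearMap.sub_apply, Module.End.mul_apply, inner_sub_left, inner_sub_right, hξ,
      hj]
    ring
  have hAj : A * j = j * A := by
    linear_combination (norm := (simp only [A]; noncomm_ring)) -(j * ξ) * hjj + hjj * (ξ * j)
  have htrace : LinearMap.trace ℝ V (A * (j * ξ * j)) = -LinearMap.trace ℝ V (A * ξ) := by
    have : j * A * j = -A := by rw [← hAj, mul_assoc, hjj, mul_neg_one]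
    rw [← mul_assoc, LinearMap.trace_mul_comm, ← mul_assoc, ← mul_assoc, this, neg_mul, map_neg]
  have hA0 : ξ - j * ξ * j = 0 := by
    refine eq_zero_of_trace_mul_self_eq_zero hA ?_
    rw [mul_sub, map_sub, htrace, h A hA hAj, neg_zero, sub_zero]
  calc ξ * j = -(j * (j * ξ * j)) := by simp only [← mul_assoc, hjj, neg_mul, one_mul, neg_neg]
    _ = -(j * ξ) := by rw [← sub_eq_zero.1 hA0]

end SkewEndomorphisms

section Frames

open Matrix

variable {E : Type*} [NormedAddCommGroup E] [NormedSpace ℝ E]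
  {H : Type*} [TopologicalSpace H] {I : ModelWithCorners ℝ E H}
  {M : Type*} [TopologicalSpace M] [ChartedSpace H M] {x : M}
  {ι : Type*}

theorem mdifferentiableAt_det [Fintype ι] [DecidableEq ι] {A : M → Matrix ι ι ℝ}
    (hA : ∀ i j, MDiffAt (fun y ↦ A y i j) x) : MDiffAt (fun y ↦ (A y).det) x := by
  have hA' : MDifferentiableAt I 𝓘(ℝ, ι → ι → ℝ) (fun y i j ↦ A y i j) x :=
    (mdifferentiableAt_iff _ _).2
      ⟨continuousAt_pi.2 fun i ↦ continuousAt_pi.2 fun j ↦ (hA i j).continuousAt,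
        differentiableWithinAt_pi.2 fun i ↦ differentiableWithinAt_pi.2 fun j ↦
          ((mdifferentiableAt_iff _ _).1 (hA i j)).2⟩
  have hdet : Differentiable ℝ (fun B : ι → ι → ℝ ↦ (of B).det) := by
    simp only [det_apply', of_apply]
    fun_prop
  exact hdet.differentiableAt.mdifferentiableAt.comp x hA'

theorem mdifferentiableAt_of_mulVec_eq [Fintype ι] [DecidableEq ι] {A : M → Matrix ι ι ℝ}
    {b c : M → ι → ℝ} (hA : ∀ i j, MDiffAt (fun y ↦ A y i j) x)
    (hb : ∀ i, MDiffAt (fun y ↦ b y i) x) (hdet : (A x).det ≠ 0)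
    (h : ∀ᶠ y in 𝓝 x, A y *ᵥ c y = b y) (i : ι) :
    MDiffAt (fun y ↦ c y i) x := by
  have hdetA := mdifferentiableAt_det hA
  have hcramer : MDiffAt (fun y ↦ (A y).cramer (b y) i) x := by
    simp only [cramer_apply]
    refine mdifferentiableAt_det fun j k ↦ ?_
    by_cases hk : k = i <;> simp [hk, hb, hA]
  refine (hcramer.div hdetA hdet).congr_of_eventuallyEq ?_
  filter_upwards [h, hdetA.continuousAt.eventually_ne hdet] with y hy hdety
  simp [← hy, cramer_eq_adjugate_mulVec, adjugate_mul, hdety, smul_mulVec]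

variable {F : Type*} [NormedAddCommGroup F] [NormedSpace ℝ F] [FiniteDimensional ℝ F]
  {V : M → Type*} [TopologicalSpace (TotalSpace F V)] [∀ x, NormedAddCommGroup (V x)]
  [∀ x, InnerProductSpace ℝ (V x)] [FiberBundle F V] [VectorBundle ℝ F V]
  [IsContMDiffRiemannianBundle I 1 F V]

theorem mdifferentiableAt_of_inner_localFrame {s : ι → Π x : M, V x} {u : Set M}
    {σ : Π x : M, V x} (hs : IsLocalFrameOn I F 1 s u) (hu : u ∈ 𝓝 x)
    (h : ∀ i, MDiffAt (fun y ↦ (inner ℝ (s i y) (σ y) : ℝ)) x) : MDiffAt (T% σ) x := by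
  classical
  have := hs.fintypeOfFiniteDimensional (mem_of_mem_nhds hu)
  have hsx (i : ι) : MDiffAt (T% (s i)) x :=
    ((hs.contMDiffOn i).contMDiffAt hu).mdifferentiableAt one_ne_zero
  refine hs.mdifferentiableAt_of_coeff (mdifferentiableAt_of_mulVec_eq
    (A := fun y ↦ gram ℝ fun i ↦ s i y) (fun i j ↦ (hsx i).inner_bundle (hsx j)) h ?_ ?_) hu
  · exact det_gram_ne_zero_iff_linearIndependent.2 (hs.linearIndependent (mem_of_mem_nhds hu))
  · filter_upwards [hu] with y hy
    ext i
    conv_rhs => rw [hs.coeff_sum_eq σ hy]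
    simp [mulVec, dotProduct, inner_sum, inner_smul_right, mul_comm]

end Frames

section Calculus

variable {E : Type*} [NormedAddCommGroup E] [NormedSpace ℝ E]
  {H : Type*} [TopologicalSpace H] {I : ModelWithCorners ℝ E H}
  {M : Type*} [TopologicalSpace M] [ChartedSpace H M] {x : M}

theorem mvfderiv_congr {F : Type*} [NormedAddCommGroup F] [NormedSpace ℝ F] {f g : M → F}
    (h : f =ᶠ[𝓝 x] g) : d% f x = d% g x := by
  ext v
  simp only [mvfderiv, ContinuousLinearMap.comp_apply]
  rw [h.mfderiv_eq]
  rfl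

variable [IsManifold I ∞ M]

theorem eventually_mdifferentiableAt {E' : Type*} [NormedAddCommGroup E'] [NormedSpace ℝ E']
    {H' : Type*} [TopologicalSpace H'] {I' : ModelWithCorners ℝ E' H'} {N : Type*}
    [TopologicalSpace N] [ChartedSpace H' N] [IsManifold I' 1 N] {f : M → N} {n : ℕ∞ω}
    (hf : CMDiffAt n f x) (hn : n ≠ 0) : ∀ᶠ y in 𝓝 x, MDiffAt f y := by
  filter_upwards [(contMDiffAt_iff_contMDiffAt_nhds (by simp)).1
    (hf.of_le (ENat.one_le_iff_ne_zero_withTop.2 hn))] with y hy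
  exact hy.mdifferentiableAt one_ne_zero

theorem mdifferentiableAt_mvfderiv_apply {F : Type*} [NormedAddCommGroup F] [NormedSpace ℝ F]
    {f : M → F} {V : Π x : M, TangentSpace I x}
    (hf : CMDiffAt 2 f x) (hV : CMDiffAt 1 (T% V) x) : MDiffAt (fun y ↦ d% f y (V y)) x := by
  have hdf : CMDiffAt 1 (fun y ↦ ContinuousLinearMap.inCoordinates E (TangentSpace I (M := M)) F
      (TangentSpace 𝓘(ℝ, F) (M := F)) x y (f x) (f y) (mfderiv% f y)) x :=
    ContMDiffAt.mfderiv_const hf (by norm_num)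
  have hdfV := ContMDiffAt.clm_apply_of_inCoordinates hdf hV (hf.of_le (by norm_num))
  exact ((contMDiff_snd_tangentBundle_modelSpace F 𝓘(ℝ, F)).contMDiffAt.comp x
    hdfV).mdifferentiableAt one_ne_zero

variable [CompleteSpace E] {U V W : Π x : M, TangentSpace I x} {f : M → ℝ}

theorem mdifferentiableAt_mlieBracket (hU : CMDiffAt 2 (T% U) x) (hV : CMDiffAt 2 (T% V) x) :
    MDiffAt (T% (mlieBracket I U V)) x := by
  have : IsManifold I (minSmoothness ℝ 2) M := by
    rw [minSmoothness_of_isRCLikeNormedField]; infer_instance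
  have : IsManifold I (((2 : ℕ∞) : ℕ∞ω) + 1) M := IsManifold.of_le (n := ∞)
    (by exact_mod_cast le_top)
  exact (ContMDiffAt.mlieBracket_vectorField (m := 1) (n := 2) hU hV
    (by simp; norm_num)).mdifferentiableAt one_ne_zero

theorem mlieBracket_mlieBracket_smul (hf : CMDiffAt 2 f x)
    (hV : CMDiffAt 2 (T% V) x) (hW : CMDiffAt 2 (T% W) x) :
    mlieBracket I U (mlieBracket I V (f • W)) x
      = d% (fun y ↦ d% f y (V y)) x (U x) • W x + d% f x (V x) • mlieBracket I U W x
        + (d% f x (U x) • mlieBracket I V W x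
          + f x • mlieBracket I U (mlieBracket I V W) x) := by
  have hVfW : mlieBracket I V (f • W) =ᶠ[𝓝 x]
      (fun y ↦ d% f y (V y)) • W + f • mlieBracket I V W := by
    filter_upwards [eventually_mdifferentiableAt hf two_ne_zero,
      eventually_mdifferentiableAt hW two_ne_zero] with y hfy hWy
    exact mlieBracket_smul_right hfy hWy
  have hVf := mdifferentiableAt_mvfderiv_apply hf (hV.of_le one_le_two)
  have hVW := mdifferentiableAt_mlieBracket hV hW
  have hf' := hf.mdifferentiableAt two_ne_zero
  have hW' := hW.mdifferentiableAt two_ne_zero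
  rw [EventuallyEq.rfl.mlieBracket_vectorField_eq hVfW,
    mlieBracket_add_right (hVf.smul_section hW') (hf'.smul_section hVW),
    mlieBracket_smul_right hVf hW', mlieBracket_smul_right hf' hVW]

theorem leibniz_mlieBracket (hU : CMDiffAt 2 (T% U) x) (hV : CMDiffAt 2 (T% V) x)
    (hW : CMDiffAt 2 (T% W) x) :
    mlieBracket I U (mlieBracket I V W) x
      = mlieBracket I (mlieBracket I U V) W x + mlieBracket I V (mlieBracket I U W) x := by
  have : IsManifold I (minSmoothness ℝ 3) M := by
    rw [minSmoothness_of_isRCLikeNormedField]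
    exact IsManifold.of_le (n := ∞) (WithTop.coe_le_coe.2 le_top)
  rw [← minSmoothness_of_isRCLikeNormedField (𝕜 := ℝ) (n := 2)] at hU hV hW
  exact leibniz_identity_mlieBracket_apply hU hV hW

theorem mvfderiv_mlieBracket (hf : CMDiffAt 2 f x) (hU : CMDiffAt 2 (T% U) x)
    (hV : CMDiffAt 2 (T% V) x) :
    d% f x (mlieBracket I U V x)
      = d% (fun y ↦ d% f y (V y)) x (U x) - d% (fun y ↦ d% f y (U y)) x (V x) := by
  rcases subsingleton_or_nontrivial (TangentSpace I x) with _ | _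
  · simp [Subsingleton.elim (mlieBracket I U V x) 0, Subsingleton.elim (U x) 0,
      Subsingleton.elim (V x) 0]
  obtain ⟨w, hw⟩ := exists_ne (0 : TangentSpace I x)
  let W : Π y : M, TangentSpace I y := extend E w
  have hW : CMDiffAt 2 (T% W) x := contMDiffAt_extend ..
  -- Compare the Jacobi identity for `U, V, f • W` with that for `U, V, W`.
  have jacobi_smul := leibniz_mlieBracket hU hV (hf.smul_section hW)
  rw [mlieBracket_mlieBracket_smul hf hV hW, mlieBracket_mlieBracket_smul hf hU hW,
    mlieBracket_smul_right (hf.mdifferentiableAt two_ne_zero) (hW.mdifferentiableAt two_ne_zero),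
    leibniz_mlieBracket hU hV hW, show W x = w by simp [W]] at jacobi_smul
  have : (d% f x (mlieBracket I U V x) - (d% (fun y ↦ d% f y (V y)) x (U x)
      - d% (fun y ↦ d% f y (U y)) x (V x))) • w = 0 := by
    linear_combination (norm := module) -jacobi_smul
  exact sub_eq_zero.1 ((smul_eq_zero.1 this).resolve_right hw)

end Calculus

section Connection

variable {E : Type*} [NormedAddCommGroup E] [NormedSpace ℝ E]
  {H : Type*} [TopologicalSpace H] {I : ModelWithCorners ℝ E H}
  {M : Type*} [TopologicalSpace M] [ChartedSpace H M] {x : M}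
  {F : Type*} [NormedAddCommGroup F] [NormedSpace ℝ F]
  {V : M → Type*} [TopologicalSpace (TotalSpace F V)]

section TopologicalFibers

variable [∀ x, AddCommGroup (V x)] [∀ x, Module ℝ (V x)] [∀ x, TopologicalSpace (V x)]
  [∀ x, IsTopologicalAddGroup (V x)] [∀ x, ContinuousSMul ℝ (V x)] [FiberBundle F V]
  {D : CovariantDerivative I F V} {σ τ : Π x : M, V x}

theorem covariantDerivative_congr (hσ : MDiffAt (T% σ) x) (h : ∀ᶠ y in 𝓝 x, σ y = τ y) :
    D σ x = D τ x :=
  D.isCovariantDerivativeOnUniv.congr_of_eventuallyEq hσ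
    (hσ.congr_of_eventuallyEq (h.mono fun y hy ↦ by simp [hy])) univ_mem h

theorem covariantDerivative_sub [VectorBundle ℝ F V] (hσ : MDiffAt (T% σ) x)
    (hτ : MDiffAt (T% τ) x) : D (fun y ↦ σ y - τ y) x = D σ x - D τ x := by
  have hD := D.isCovariantDerivativeOnUniv
  have hτ' : MDiffAt (T% ((-1 : ℝ) • τ)) x := mdifferentiableAt_const.smul_section hτ
  have hsub : (fun y ↦ σ y - τ y) = σ + (-1 : ℝ) • τ := by
    ext y
    simp [sub_eq_add_neg]
  rw [hsub, hD.add hσ hτ', hD.smul_const (-1) hτ, neg_one_smul, sub_eq_add_neg]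

/-- The covariant derivatives `D_X σ` of `C²` sections along `C²` vector fields are differentiable.
In contrast to Mathlib's `ContMDiffCovariantDerivative`, the regularity of the fields is only
required at the point considered. -/
def IsRegularConnection [IsManifold I 1 M] (D : CovariantDerivative I F V) : Prop :=
  ∀ ⦃x : M⦄ ⦃X : Π x : M, TangentSpace I x⦄ ⦃σ : Π x : M, V x⦄,
    CMDiffAt 2 (T% X) x → CMDiffAt 2 (T% σ) x → MDiffAt (T% (fun y ↦ D σ y (X y))) x

/-- The curvature `D_{[X,Y]} σ - (D_X D_Y σ - D_Y D_X σ)` of the connection `D`. -/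
def curvatureField (D : CovariantDerivative I F V) (X Y : Π x : M, TangentSpace I x)
    (σ : Π x : M, V x) (x : M) : V x :=
  D σ x (mlieBracket I X Y x)
    - (D (fun y ↦ D σ y (Y y)) x (X x) - D (fun y ↦ D σ y (X y)) x (Y x))

theorem curvatureField_swap (D : CovariantDerivative I F V) (X Y : Π x : M, TangentSpace I x)
    (σ : Π x : M, V x) (x : M) : curvatureField D Y X σ x = -curvatureField D X Y σ x := by
  rw [curvatureField, curvatureField, mlieBracket_swap_apply, map_neg]
  abel

end TopologicalFibers

section Metric

variable [FiniteDimensional ℝ F] [∀ x, NormedAddCommGroup (V x)] [∀ x, InnerProductSpace ℝ (V x)]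
  [FiberBundle F V] [VectorBundle ℝ F V] [IsManifold I ∞ M] [ContMDiffVectorBundle 2 F V I]
  [IsContMDiffRiemannianBundle I 2 F V] {D : CovariantDerivative I F V}
  {X Y : Π x : M, TangentSpace I x} {σ τ : Π x : M, V x}

theorem mvfderiv_mvfderiv_inner (hD : D.IsMetricCompatible) (hreg : IsRegularConnection D)
    (hY : CMDiffAt 2 (T% Y) x) (hσ : CMDiffAt 2 (T% σ) x) (hτ : CMDiffAt 2 (T% τ) x) :
    d% (fun y ↦ d% (fun z ↦ (inner ℝ (σ z) (τ z) : ℝ)) y (Y y)) x (X x)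
      = inner ℝ (D (fun y ↦ D σ y (Y y)) x (X x)) (τ x)
        + inner ℝ (D σ x (Y x)) (D τ x (X x))
        + (inner ℝ (D σ x (X x)) (D τ x (Y x))
          + inner ℝ (σ x) (D (fun y ↦ D τ y (Y y)) x (X x))) := by
  have h : (fun y ↦ d% (fun z ↦ (inner ℝ (σ z) (τ z) : ℝ)) y (Y y)) =ᶠ[𝓝 x]
      fun y ↦ inner ℝ (D σ y (Y y)) (τ y) + inner ℝ (σ y) (D τ y (Y y)) := by
    filter_upwards [eventually_mdifferentiableAt hσ two_ne_zero,
      eventually_mdifferentiableAt hτ two_ne_zero] with y hσy hτy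
    exact hD.mvfderiv_inner_eq Y hσy hτy
  have hσ' := hσ.mdifferentiableAt two_ne_zero
  have hτ' := hτ.mdifferentiableAt two_ne_zero
  have hYσ := hreg hY hσ
  have hYτ := hreg hY hτ
  rw [mvfderiv_congr h, mvfderiv_fun_add (hYσ.inner_bundle hτ') (hσ'.inner_bundle hYτ), add_apply]
  exact congr($(hD.mvfderiv_inner_eq X hYσ hτ') + $(hD.mvfderiv_inner_eq X hσ' hYτ))

theorem inner_curvatureField [CompleteSpace E] (hD : D.IsMetricCompatible)
    (hreg : IsRegularConnection D) (hX : CMDiffAt 2 (T% X) x) (hY : CMDiffAt 2 (T% Y) x)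
    (hσ : CMDiffAt 2 (T% σ) x) (hτ : CMDiffAt 2 (T% τ) x) :
    (inner ℝ (curvatureField D X Y σ x) (τ x) : ℝ)
      = -inner ℝ (σ x) (curvatureField D X Y τ x) := by
  -- Expand `d⟨σ, τ⟩ [X, Y] = X (Y ⟨σ, τ⟩) - Y (X ⟨σ, τ⟩)` in terms of `D`.
  have h := mvfderiv_mlieBracket (hσ.inner_bundle hτ) hX hY
  have hbracket := hD.mvfderiv_inner_eq (mlieBracket I X Y)
    (hσ.mdifferentiableAt two_ne_zero) (hτ.mdifferentiableAt two_ne_zero)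
  rw [mvfderiv_mvfderiv_inner hD hreg hY hσ hτ, mvfderiv_mvfderiv_inner hD hreg hX hσ hτ] at h
  beta_reduce at hbracket
  simp only [curvatureField, inner_sub_left, inner_sub_right]
  linear_combination h - hbracket

end Metric

end Connection

section TorsionFree

variable {E : Type*} [NormedAddCommGroup E] [NormedSpace ℝ E] [FiniteDimensional ℝ E]
  {H : Type*} [TopologicalSpace H] {I : ModelWithCorners ℝ E H}
  {M : Type*} [TopologicalSpace M] [ChartedSpace H M] [IsManifold I ∞ M] {x : M}
  {D : CovariantDerivative I E (fun x : M ↦ TangentSpace I x)}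
  {X Y Z : Π x : M, TangentSpace I x}

/-- The second covariant derivative `(∇²_{X,Y} Z)(x) = ∇_X ∇_Y Z - ∇_{∇_X Y} Z`, with `D` for
`∇`. -/
def secondCovDeriv (D : CovariantDerivative I E (fun x : M ↦ TangentSpace I x))
    (X Y Z : Π x : M, TangentSpace I x) (x : M) : TangentSpace I x :=
  D (fun y ↦ D Z y (Y y)) x (X x) - D Z x (D Y x (X x))

theorem curvatureField_eq_secondCovDeriv_sub (hD : D.torsion = 0) (hX : MDiffAt (T% X) x)
    (hY : MDiffAt (T% Y) x) :
    curvatureField D X Y Z x = secondCovDeriv D Y X Z x - secondCovDeriv D X Y Z x := by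
  have : CompleteSpace E := FiniteDimensional.complete ℝ E
  rw [curvatureField, ← D.torsion_eq_zero_iff.1 hD hX hY, secondCovDeriv, secondCovDeriv, map_sub]
  abel

theorem mlieBracket_mlieBracket_of_torsion_eq_zero (hD : D.torsion = 0)
    (hreg : IsRegularConnection D) (hX : CMDiffAt 2 (T% X) x) (hY : CMDiffAt 2 (T% Y) x)
    (hZ : CMDiffAt 2 (T% Z) x) :
    mlieBracket I X (mlieBracket I Y Z) x
      = D (fun y ↦ D Z y (Y y)) x (X x) - D (fun y ↦ D Y y (Z y)) x (X x)
        - D X x (mlieBracket I Y Z x) := by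
  have : CompleteSpace E := FiniteDimensional.complete ℝ E
  have hYZ := mdifferentiableAt_mlieBracket hY hZ
  have h : ∀ᶠ y in 𝓝 x, mlieBracket I Y Z y = D Z y (Y y) - D Y y (Z y) := by
    filter_upwards [eventually_mdifferentiableAt hY two_ne_zero,
      eventually_mdifferentiableAt hZ two_ne_zero] with y hYy hZy
    exact (D.torsion_eq_zero_iff.1 hD hYy hZy).symm
  rw [← D.torsion_eq_zero_iff.1 hD (hX.mdifferentiableAt two_ne_zero) hYZ,
    covariantDerivative_congr hYZ h, covariantDerivative_sub (hreg hY hZ) (hreg hZ hY), sub_apply]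

theorem curvatureField_cyclic (hD : D.torsion = 0) (hreg : IsRegularConnection D)
    (hX : CMDiffAt 2 (T% X) x) (hY : CMDiffAt 2 (T% Y) x) (hZ : CMDiffAt 2 (T% Z) x) :
    curvatureField D X Y Z x + curvatureField D Y Z X x + curvatureField D Z X Y x = 0 := by
  have : CompleteSpace E := FiniteDimensional.complete ℝ E
  have hswap : mlieBracket I Y (mlieBracket I X Z) x
      = -mlieBracket I Y (mlieBracket I Z X) x := by
    rw [mlieBracket_swap (V := X)]
    simpa using mlieBracket_const_smul_right (I := I) (V := Y) (c := (-1 : ℝ))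
      (mdifferentiableAt_mlieBracket hZ hX)
  have jacobi := leibniz_mlieBracket hX hY hZ
  rw [mlieBracket_swap_apply (V := mlieBracket I X Y), hswap,
    mlieBracket_mlieBracket_of_torsion_eq_zero hD hreg hX hY hZ,
    mlieBracket_mlieBracket_of_torsion_eq_zero hD hreg hY hZ hX,
    mlieBracket_mlieBracket_of_torsion_eq_zero hD hreg hZ hX hY] at jacobi
  simp only [curvatureField]
  linear_combination (norm := module) -jacobi

end TorsionFree

section LeviCivita

variable {E : Type*} [NormedAddCommGroup E] [NormedSpace ℝ E] [FiniteDimensional ℝ E]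
  {H : Type*} [TopologicalSpace H] {I : ModelWithCorners ℝ E H}
  {M : Type*} [TopologicalSpace M] [ChartedSpace H M] [IsManifold I ∞ M]
  [RiemannianBundle (fun x : M ↦ TangentSpace I x)]
  [IsContMDiffRiemannianBundle I ∞ E (fun x : M ↦ TangentSpace I x)] {x : M}

section Fields

variable {X Y Z : Π x : M, TangentSpace I x}

omit [FiniteDimensional ℝ E] in
theorem contMDiffAt_inner (hX : CMDiffAt 2 (T% X) x) (hY : CMDiffAt 2 (T% Y) x) :
    CMDiffAt 2 (fun y ↦ (inner ℝ (X y) (Y y) : ℝ)) x :=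
  ContMDiffAt.inner_bundle (E := fun x : M ↦ TangentSpace I x) (b := fun y : M ↦ y) (IB := I)
    (F := E) (v := X) (w := Y) hX hY

theorem mdifferentiableAt_koszul (hX : CMDiffAt 2 (T% X) x) (hY : CMDiffAt 2 (T% Y) x)
    (hZ : CMDiffAt 2 (T% Z) x) : MDiffAt (koszul X Y Z) x := by
  have : CompleteSpace E := FiniteDimensional.complete ℝ E
  have hX' := hX.mdifferentiableAt two_ne_zero
  have hY' := hY.mdifferentiableAt two_ne_zero
  have hZ' := hZ.mdifferentiableAt two_ne_zero
  have derivative {A B C : Π x : M, TangentSpace I x} (hA : CMDiffAt 2 (T% A) x)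
      (hB : CMDiffAt 2 (T% B) x) (hC : CMDiffAt 2 (T% C) x) :
      MDiffAt (fun y ↦ d% (fun z ↦ (inner ℝ (A z) (B z) : ℝ)) y (C y)) x :=
    mdifferentiableAt_mvfderiv_apply (contMDiffAt_inner hA hB) (hC.of_le one_le_two)
  exact (((((derivative hY hZ hX).add (derivative hX hZ hY)).sub (derivative hX hY hZ)).add
    (inner_mdiff (mdifferentiableAt_mlieBracket hX hY) hZ')).sub
    (inner_mdiff (mdifferentiableAt_mlieBracket hX hZ) hY')).sub
    (inner_mdiff (mdifferentiableAt_mlieBracket hY hZ) hX')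

theorem isRegularConnection_leviCivita : IsRegularConnection (leviCivita I M) := by
  intro x X Y hX hY
  let t := trivializationAt E (fun x : M ↦ TangentSpace I x) x
  have hx : x ∈ t.baseSet := mem_baseSet_trivializationAt ..
  let b := Module.finBasis ℝ E
  refine mdifferentiableAt_of_inner_localFrame (V := fun x : M ↦ TangentSpace I x)
    (t.isLocalFrameOn_localFrame_baseSet I 1 b) (t.open_baseSet.mem_nhds hx) fun i ↦ ?_
  have hs : CMDiffAt 2 (T% (t.localFrame b i)) x :=
    (t.isLocalFrameOn_localFrame_baseSet I 2 b).contMDiffAt t.open_baseSet hx i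
  refine (mdifferentiableAt_const.mul (mdifferentiableAt_koszul hX hY hs)).congr_of_eventuallyEq
    (f := fun y ↦ 2⁻¹ * koszul X Y (t.localFrame b i) y) ?_
  filter_upwards [eventually_mdifferentiableAt hX two_ne_zero,
    eventually_mdifferentiableAt hY two_ne_zero, eventually_mdifferentiableAt hs two_ne_zero]
    with y hXy hYy hsy
  rw [real_inner_comm, inner_leviCivita hXy hYy hsy]

end Fields

section Curvature

variable (u v w z : TangentSpace I x)

theorem curvature_swap : curvature x v u w = -curvature x u v w :=
  curvatureField_swap (leviCivita I M) _ _ _ _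

theorem curvature_cyclic : curvature x u v w + curvature x v w u + curvature x w u v = 0 :=
  curvatureField_cyclic leviCivita_torsion isRegularConnection_leviCivita
    (contMDiffAt_extend ..) (contMDiffAt_extend ..) (contMDiffAt_extend ..)

theorem inner_curvatureField_extend {W Z : Π x : M, TangentSpace I x} (hW : CMDiffAt 2 (T% W) x)
    (hZ : CMDiffAt 2 (T% Z) x) :
    (inner ℝ (curvatureField (leviCivita I M) (extend E u) (extend E v) W x) (Z x) : ℝ)
      = -inner ℝ (curvatureField (leviCivita I M) (extend E u) (extend E v) Z x) (W x) := by
  have : CompleteSpace E := FiniteDimensional.complete ℝ E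
  have : IsContMDiffRiemannianBundle I 2 E (fun x : M ↦ TangentSpace I x) := inferInstance
  rw [real_inner_comm (W x)]
  exact inner_curvatureField leviCivita_isMetricCompatible isRegularConnection_leviCivita
    (contMDiffAt_extend ..) (contMDiffAt_extend ..) hW hZ

theorem inner_curvature_comm :
    (inner ℝ (curvature x u v w) z : ℝ) = -inner ℝ (curvature x u v z) w := by
  have h := inner_curvatureField_extend u v (contMDiffAt_extend I E w) (contMDiffAt_extend I E z)
  rwa [extend_apply_self, extend_apply_self] at h

theorem curvature_apply_eq_secondCovDeriv_sub {W : Π x : M, TangentSpace I x}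
    (hW : CMDiffAt 2 (T% W) x) :
    curvature x u v (W x)
      = secondCovDeriv (leviCivita I M) (extend E v) (extend E u) W x
        - secondCovDeriv (leviCivita I M) (extend E u) (extend E v) W x := by
  rw [← curvatureField_eq_secondCovDeriv_sub leviCivita_torsion (mdifferentiableAt_extend I E u)
    (mdifferentiableAt_extend I E v)]
  refine ext_inner_right ℝ fun z ↦ ?_
  have h := inner_curvatureField_extend u v hW (contMDiffAt_extend I E z)
  rw [extend_apply_self] at h
  rw [h, inner_curvature_comm]
  rfl

theorem inner_curvature_pair_comm :
    (inner ℝ (curvature x u v w) z : ℝ) = inner ℝ (curvature x w z u) v :=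
  pair_symm_of_cyclic (r := fun a b c d ↦ (inner ℝ (curvature x a b c) d : ℝ))
    (fun a b c d ↦ by rw [curvature_swap, inner_neg_left])
    (fun a b c d ↦ inner_curvature_comm a b d c)
    (fun a b c d ↦ by rw [← inner_add_left, ← inner_add_left, curvature_cyclic, inner_zero_left])
    u v w z

/-- The endomorphism `v ↦ R_{u,v} w`, whose trace is `Ric(u, w)`. -/
def curvatureMap : Module.End ℝ (TangentSpace I x) where
  toFun v := curvature x u v w
  map_add' v v' := ext_inner_right ℝ fun z ↦ by
    simp only [inner_add_left, inner_curvature_pair_comm u _ w, inner_add_right]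
  map_smul' c v := ext_inner_right ℝ fun z ↦ by
    simp only [inner_smul_left, inner_curvature_pair_comm u _ w, inner_smul_right, conj_trivial,
      RingHom.id_apply]

theorem curvature_neg : curvature x u v (-w) = -curvature x u v w :=
  ext_inner_right ℝ fun z ↦ by
    rw [inner_curvature_comm, inner_neg_right, inner_neg_left, inner_curvature_comm u v w]

end Curvature

section Ricci

variable {ι : Type*} [Fintype ι] (J : OrthogonalAlmostComplexStructure I M)
  (e : OrthonormalBasis ι ℝ (TangentSpace I x)) (X Y : TangentSpace I x)

theorem ricci_eq_trace : ricci x X Y = LinearMap.trace ℝ _ (curvatureMap X Y) :=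
  sum_inner_apply_eq_trace (stdOrthonormalBasis ℝ (TangentSpace I x)) (curvatureMap X Y)

theorem ricci_eq_sum : ricci x X Y = ∑ i, inner ℝ (curvature x X (e i) Y) (e i) := by
  rw [ricci_eq_trace]
  exact (sum_inner_apply_eq_trace e (curvatureMap X Y)).symm

theorem ricci_comm : ricci x X Y = ricci x Y X :=
  Finset.sum_congr rfl fun _ _ ↦ inner_curvature_pair_comm _ _ _ _

theorem sum_inner_curvature_J :
    ∑ i, (inner ℝ (curvature x X (e i) (J x Y)) (J x (e i)) : ℝ)
      = -LinearMap.trace ℝ _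
        ((J x : Module.End ℝ (TangentSpace I x)) * curvatureMap X (J x Y)) :=
  sum_inner_apply_eq_neg_trace_mul e (inner_J J x) (curvatureMap X (J x Y))

theorem ricciStar_eq_sum :
    ricciStar J x X Y = ∑ i, inner ℝ (curvature x X (e i) (J x Y)) (J x (e i)) := by
  rw [sum_inner_curvature_J, ricciStar, sum_inner_curvature_J]

theorem ricciStar_J : ricciStar J x (J x X) (J x Y) = ricciStar J x Y X := by
  let b := stdOrthonormalBasis ℝ (TangentSpace I x)
  have h : ricciStar J x Y X = LinearMap.trace ℝ _
      (curvatureMap (J x X) Y * (J x : Module.End ℝ (TangentSpace I x))) := by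
    rw [← sum_inner_apply_eq_trace b]
    exact Finset.sum_congr rfl fun i _ ↦ inner_curvature_pair_comm _ _ _ _
  rw [h, LinearMap.trace_mul_comm, ← sum_inner_apply_eq_trace b]
  refine Finset.sum_congr rfl fun i _ ↦ ?_
  rw [J.sq, curvature_neg, inner_neg_left, ← inner_J J]
  rfl

theorem antiHermitianPart_ricci_comm :
    antiHermitianPart J (ricci x) Y X = antiHermitianPart J (ricci x) X Y := by
  simp only [antiHermitianPart, ricci_comm Y, ricci_comm (J x Y)]

theorem antiHermitianPart_ricciStar_swap :
    antiHermitianPart J (ricciStar J x) Y X = -antiHermitianPart J (ricciStar J x) X Y := by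
  simp only [antiHermitianPart, ricciStar_J]
  ring

end Ricci

variable (J : OrthogonalAlmostComplexStructure I M)

section IntrinsicTorsion

variable {X Y : Π x : M, TangentSpace I x}

omit [FiniteDimensional ℝ E] [IsContMDiffRiemannianBundle I ∞ E (fun x : M ↦ TangentSpace I x)] in
theorem contMDiffAt_J (hY : CMDiffAt 2 (T% Y) x) : CMDiffAt 2 (T% (fun y ↦ J y (Y y))) x :=
  ContMDiffAt.clm_bundle_apply (𝕜 := ℝ) (F₁ := E) (F₂ := E) (b := fun y : M ↦ y)
    (E₁ := fun x : M ↦ TangentSpace I x) (E₂ := fun x : M ↦ TangentSpace I x)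
    ((J.contMDiff_toFun.of_le (WithTop.coe_le_coe.2 le_top)).contMDiffAt) hY

theorem minimalUnitaryConnection_apply (hY : MDiffAt (T% Y) x) (v : TangentSpace I x) :
    minimalUnitaryConnection J Y x v = leviCivita I M Y x v + intrinsicTorsion J x v (Y x) := by
  rw [intrinsicTorsion, difference_apply _ _ hY, add_sub_cancel]

/-- The intrinsic torsion as a bilinear map: `intrinsicTorsionMap J x u v = ξ_u v`. -/
def intrinsicTorsionMap (x : M) :
    TangentSpace I x →ₗ[ℝ] TangentSpace I x →ₗ[ℝ] TangentSpace I x :=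
  LinearMap.mk₂ ℝ (intrinsicTorsion J x) (fun _ _ _ ↦ by simp [intrinsicTorsion])
    (fun _ _ _ ↦ by simp [intrinsicTorsion]) (fun _ _ _ ↦ by simp [intrinsicTorsion])
    (fun _ _ _ ↦ by simp [intrinsicTorsion])

theorem intrinsicTorsionMap_apply (u v : TangentSpace I x) :
    intrinsicTorsionMap J x u v = intrinsicTorsion J x u v := rfl

theorem inner_intrinsicTorsion (u v w : TangentSpace I x) :
    (inner ℝ (intrinsicTorsion J x u v) w : ℝ) = -inner ℝ v (intrinsicTorsion J x u w) := by
  have hV : MDiffAt (T% (extend E v)) x := mdifferentiableAt_extend ..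
  have hW : MDiffAt (T% (extend E w)) x := mdifferentiableAt_extend ..
  have h := leviCivita_isMetricCompatible.mvfderiv_inner_eq (extend E u) hV hW
  have h' := (isMinimalUnitaryConnection_minimalUnitaryConnection J).metric.mvfderiv_inner_eq
    (extend E u) hV hW
  simp only [minimalUnitaryConnection_apply J hV, minimalUnitaryConnection_apply J hW,
    extend_apply_self, inner_add_left, inner_add_right] at h h'
  linarith

theorem intrinsicTorsion_J (u v : TangentSpace I x) :
    intrinsicTorsion J x u (J x v) = -J x (intrinsicTorsion J x u v) := by
  have h := mul_eq_neg_mul_of_trace_eq_zero (j := (J x : Module.End ℝ (TangentSpace I x)))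
    (ξ := intrinsicTorsionMap J x u) (inner_J J x) (LinearMap.ext (J.sq x))
    (inner_intrinsicTorsion J u) fun A hA hAJ ↦ by
      rw [← neg_eq_zero, ← sum_inner_apply_eq_neg_trace_mul (stdOrthonormalBasis ℝ _) hA]
      exact (isMinimalUnitaryConnection_minimalUnitaryConnection J).orthogonal x u A hA
        (LinearMap.congr_fun hAJ)
  exact LinearMap.congr_fun h v

theorem leviCivita_J (hY : MDiffAt (T% Y) x) (v : TangentSpace I x) :
    leviCivita I M (fun y ↦ J y (Y y)) x v
      = J x (leviCivita I M Y x v) + (2 : ℝ) • J x (intrinsicTorsion J x v (Y x)) := by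
  have h := (isMinimalUnitaryConnection_minimalUnitaryConnection J).parallel Y x hY v
  rw [minimalUnitaryConnection_apply J hY, minimalUnitaryConnection_apply J (mdiff_J J hY),
    intrinsicTorsion_J, map_add] at h
  linear_combination (norm := module) h

theorem mdifferentiableAt_intrinsicTorsion (hX : CMDiffAt 2 (T% X) x)
    (hY : CMDiffAt 2 (T% Y) x) :
    MDiffAt (T% (fun y ↦ intrinsicTorsion J y (X y) (Y y))) x := by
  have h := (mdifferentiableAt_const (c := (-2⁻¹ : ℝ))).smul_section
    (mdifferentiableAt_add_section
      (mdiff_J J (isRegularConnection_leviCivita hX (contMDiffAt_J J hY)))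
      (isRegularConnection_leviCivita hX hY))
  refine h.congr_of_eventuallyEq ?_
  filter_upwards [eventually_mdifferentiableAt hY two_ne_zero] with y hy
  have : intrinsicTorsion J y (X y) (Y y) = (-2⁻¹ : ℝ) •
      (J y (leviCivita I M (fun z ↦ J z (Y z)) y (X y)) + leviCivita I M Y y (X y)) := by
    rw [leviCivita_J J hy, map_add, map_smul, J.sq, J.sq]
    module
  rw [this]
  rfl

end IntrinsicTorsion

section CovDerivTensor

variable (v a b : TangentSpace I x)

theorem covDerivTensor_complexIntrinsicTorsion :
    covDerivTensor (leviCivita I M) (complexIntrinsicTorsion J) x v a b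
      = J x (covDerivTensor (minimalUnitaryConnection J) (intrinsicTorsion J) x v a b
        + intrinsicTorsion J x v (intrinsicTorsion J x a b)
        + intrinsicTorsion J x a (intrinsicTorsion J x v b)
        + intrinsicTorsion J x (intrinsicTorsion J x v a) b) := by
  have hA : CMDiffAt 2 (T% (extend E a)) x := contMDiffAt_extend ..
  have hB : CMDiffAt 2 (T% (extend E b)) x := contMDiffAt_extend ..
  have hξ := mdifferentiableAt_intrinsicTorsion J hA hB
  simp only [covDerivTensor, complexIntrinsicTorsion, leviCivita_J J hξ,
    minimalUnitaryConnection_apply J hξ,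
    minimalUnitaryConnection_apply J (hA.mdifferentiableAt two_ne_zero),
    minimalUnitaryConnection_apply J (hB.mdifferentiableAt two_ne_zero),
    extend_apply_self]
  simp only [← intrinsicTorsionMap_apply, map_add, map_sub, LinearMap.add_apply]
  module

theorem two_smul_covDerivTensor_complexIntrinsicTorsion :
    (2 : ℝ) • covDerivTensor (leviCivita I M) (complexIntrinsicTorsion J) x v a b
      = secondCovDeriv (leviCivita I M) (extend E v) (extend E a) (fun y ↦ J y (extend E b y)) x
        - J x (secondCovDeriv (leviCivita I M) (extend E v) (extend E a) (extend E b) x)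
        - (2 : ℝ) • J x (intrinsicTorsion J x v (leviCivita I M (extend E b) x a))
        - (2 : ℝ) • J x (intrinsicTorsion J x a (leviCivita I M (extend E b) x v)) := by
  have hA : CMDiffAt 2 (T% (extend E a)) x := contMDiffAt_extend ..
  have hB : CMDiffAt 2 (T% (extend E b)) x := contMDiffAt_extend ..
  have hAB := isRegularConnection_leviCivita hA hB
  have hξ : MDiffAt (T% (fun y ↦ complexIntrinsicTorsion J y (extend E a y) (extend E b y))) x :=
    mdiff_J J (mdifferentiableAt_intrinsicTorsion J hA hB)
  have h : (2 : ℝ) • leviCivita I M (fun y ↦ complexIntrinsicTorsion J y (extend E a y)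
        (extend E b y)) x
      = leviCivita I M (fun y ↦ leviCivita I M (fun z ↦ J z (extend E b z)) y (extend E a y)) x
        - leviCivita I M (fun y ↦ J y (leviCivita I M (extend E b) y (extend E a y))) x := by
    rw [← (leviCivita I M).isCovariantDerivativeOnUniv.smul_const _ hξ,
      ← covariantDerivative_sub (V := fun x : M ↦ TangentSpace I x)
        (isRegularConnection_leviCivita hA (contMDiffAt_J J hB)) (mdiff_J J hAB)]
    refine covariantDerivative_congr (V := fun x : M ↦ TangentSpace I x)
      ((mdifferentiableAt_const (c := (2 : ℝ))).smul_section hξ) ?_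
    filter_upwards [eventually_mdifferentiableAt hB two_ne_zero] with y hy
    simp [leviCivita_J J hy, complexIntrinsicTorsion]
  have hv := congr($h v)
  simp only [sub_apply, smul_apply, leviCivita_J J hAB, extend_apply_self] at hv
  simp only [complexIntrinsicTorsion] at hv
  simp only [covDerivTensor, complexIntrinsicTorsion, secondCovDeriv, extend_apply_self, map_sub,
    leviCivita_J J (hB.mdifferentiableAt two_ne_zero)]
  linear_combination (norm := module) hv

theorem curvature_J_sub_J_curvature :
    curvature x a v (J x b) - J x (curvature x a v b)
      = (2 : ℝ) • (covDerivTensor (leviCivita I M) (complexIntrinsicTorsion J) x v a b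
        - covDerivTensor (leviCivita I M) (complexIntrinsicTorsion J) x a v b) := by
  have hB : CMDiffAt 2 (T% (extend E b)) x := contMDiffAt_extend ..
  have h := curvature_apply_eq_secondCovDeriv_sub a v hB
  have hJ := curvature_apply_eq_secondCovDeriv_sub a v (contMDiffAt_J J hB)
  rw [extend_apply_self] at h hJ
  rw [h, hJ, smul_sub, two_smul_covDerivTensor_complexIntrinsicTorsion,
    two_smul_covDerivTensor_complexIntrinsicTorsion, map_sub]
  module

end CovDerivTensor

section RicciDifference

variable {ι : Type*} [Fintype ι] (e : OrthonormalBasis ι ℝ (TangentSpace I x))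
  (X Y : TangentSpace I x)

theorem ricciStar_sub_ricci_eq_sum_covDerivTensor_leviCivita :
    ricciStar J x X Y - ricci x X Y
      = 2 * ∑ i, inner ℝ (covDerivTensor (leviCivita I M) (complexIntrinsicTorsion J) x
          (e i) X (J x Y)) (e i)
        - 2 * ∑ i, inner ℝ (covDerivTensor (leviCivita I M) (complexIntrinsicTorsion J) x
          X (e i) (J x Y)) (e i) := by
  rw [ricciStar_eq_sum J e, ricci_eq_sum e, ← Finset.sum_sub_distrib, ← mul_sub,
    ← Finset.sum_sub_distrib, Finset.mul_sum]
  refine Finset.sum_congr rfl fun i _ ↦ ?_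
  have h := congr(inner ℝ $(curvature_J_sub_J_curvature J (e i) X (J x Y)) (e i))
  simp only [J.sq, curvature_neg, inner_sub_left, inner_neg_left, inner_J, inner_smul_left,
    conj_trivial] at h
  linarith

theorem ricciStar_sub_ricci_eq_sum_covDerivTensor_minimalUnitaryConnection :
    ricciStar J x X Y - ricci x X Y
      = 2 * ∑ i, inner ℝ (covDerivTensor (minimalUnitaryConnection J) (intrinsicTorsion J) x
          (e i) X Y) (e i)
        - 2 * ∑ i, inner ℝ (covDerivTensor (minimalUnitaryConnection J) (intrinsicTorsion J) x
          X (e i) Y) (e i)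
        + 2 * ∑ i, inner ℝ (intrinsicTorsion J x (intrinsicTorsion J x (e i) X) Y) (e i)
        - 2 * ∑ i, inner ℝ (intrinsicTorsion J x (intrinsicTorsion J x X (e i)) Y) (e i) := by
  rw [ricciStar_eq_sum J e, ricci_eq_sum e]
  simp only [Finset.mul_sum, ← Finset.sum_add_distrib, ← Finset.sum_sub_distrib]
  refine Finset.sum_congr rfl fun i _ ↦ ?_
  have h := congr(inner ℝ $(curvature_J_sub_J_curvature J (e i) X Y) (J x (e i)))
  simp only [covDerivTensor_complexIntrinsicTorsion, inner_sub_left, inner_add_left,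
    inner_smul_left, conj_trivial, J.orthogonal] at h
  linarith

theorem sum_inner_intrinsicTorsion_intrinsicTorsion_comm :
    ∑ i, (inner ℝ (intrinsicTorsion J x (intrinsicTorsion J x (e i) X) Y) (e i) : ℝ)
      = ∑ i, inner ℝ (intrinsicTorsion J x (intrinsicTorsion J x (e i) Y) X) (e i) := by
  let ξ := (intrinsicTorsionMap J x).flip
  calc _ = LinearMap.trace ℝ _ (ξ Y * ξ X) := sum_inner_apply_eq_trace e (ξ Y * ξ X)
    _ = LinearMap.trace ℝ _ (ξ X * ξ Y) := LinearMap.trace_mul_comm ..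
    _ = _ := (sum_inner_apply_eq_trace e (ξ X * ξ Y)).symm

end RicciDifference

end LeviCivita

end AlmostHermitian

end

open AlmostHermitian in
theorem lemma3p1_general {E : Type*} [NormedAddCommGroup E] [NormedSpace ℝ E]
    [FiniteDimensional ℝ E] {H : Type*} [TopologicalSpace H] {I : ModelWithCorners ℝ E H}
    {M : Type*} [TopologicalSpace M] [ChartedSpace H M] [IsManifold I ∞ M]
    [RiemannianBundle (fun x : M ↦ TangentSpace I x)]
    [IsContMDiffRiemannianBundle I ∞ E (fun x : M ↦ TangentSpace I x)]
    (J : OrthogonalAlmostComplexStructure I M) {x : M} {ι : Type*} [Fintype ι]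
    (e : OrthonormalBasis ι ℝ (TangentSpace I x)) (X Y : TangentSpace I x) :
    let ξ := intrinsicTorsion J x
    let DJξ := covDerivTensor (leviCivita I M) (complexIntrinsicTorsion J) x
    let Dξ := covDerivTensor (minimalUnitaryConnection J) (intrinsicTorsion J) x
    let Ric := ricci x
    let RicS := ricciStar J x
    let H := hermitianPart J (x := x)
    let AH := antiHermitianPart J (x := x)
    (RicS X Y - Ric X Y
      = 2 * ∑ i, inner ℝ (DJξ (e i) X (J x Y)) (e i)
        - 2 * ∑ i, inner ℝ (DJξ X (e i) (J x Y)) (e i)) ∧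
    (RicS X Y - Ric X Y
      = 2 * ∑ i, inner ℝ (Dξ (e i) X Y) (e i)
        - 2 * ∑ i, inner ℝ (Dξ X (e i) Y) (e i)
        + 2 * ∑ i, inner ℝ (ξ (ξ (e i) X) Y) (e i)
        - 2 * ∑ i, inner ℝ (ξ (ξ X (e i)) Y) (e i)) ∧
    (H RicS X Y - H Ric X Y
      = ∑ i, inner ℝ (Dξ (e i) X Y) (e i)
        - ∑ i, inner ℝ (Dξ X (e i) Y) (e i)
        + ∑ i, inner ℝ (Dξ (e i) (J x X) (J x Y)) (e i)
        - ∑ i, inner ℝ (Dξ (J x X) (e i) (J x Y)) (e i)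
        + ∑ i, inner ℝ (ξ (ξ (e i) X) Y) (e i)
        - ∑ i, inner ℝ (ξ (ξ X (e i)) Y) (e i)
        + ∑ i, inner ℝ (ξ (ξ (e i) (J x X)) (J x Y)) (e i)
        - ∑ i, inner ℝ (ξ (ξ (J x X) (e i)) (J x Y)) (e i)) ∧
    (2 * AH RicS X Y
      = ∑ i, inner ℝ (Dξ (e i) X Y) (e i)
        - ∑ i, inner ℝ (Dξ (e i) Y X) (e i)
        - ∑ i, inner ℝ (Dξ (e i) (J x X) (J x Y)) (e i)
        + ∑ i, inner ℝ (Dξ (e i) (J x Y) (J x X)) (e i)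
        - ∑ i, inner ℝ (Dξ X (e i) Y) (e i)
        + ∑ i, inner ℝ (Dξ Y (e i) X) (e i)
        + ∑ i, inner ℝ (Dξ (J x X) (e i) (J x Y)) (e i)
        - ∑ i, inner ℝ (Dξ (J x Y) (e i) (J x X)) (e i)
        - ∑ i, inner ℝ (ξ (ξ X (e i)) Y) (e i)
        + ∑ i, inner ℝ (ξ (ξ Y (e i)) X) (e i)
        + ∑ i, inner ℝ (ξ (ξ (J x X) (e i)) (J x Y)) (e i)
        - ∑ i, inner ℝ (ξ (ξ (J x Y) (e i)) (J x X)) (e i)) ∧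
    (2 * AH Ric X Y
      = - ∑ i, inner ℝ (Dξ (e i) X Y) (e i)
        + ∑ i, inner ℝ (Dξ X (e i) Y) (e i)
        - ∑ i, inner ℝ (Dξ (e i) Y X) (e i)
        + ∑ i, inner ℝ (Dξ Y (e i) X) (e i)
        + ∑ i, inner ℝ (Dξ (e i) (J x X) (J x Y)) (e i)
        - ∑ i, inner ℝ (Dξ (J x X) (e i) (J x Y)) (e i)
        + ∑ i, inner ℝ (Dξ (e i) (J x Y) (J x X)) (e i)
        - ∑ i, inner ℝ (Dξ (J x Y) (e i) (J x X)) (e i)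
        - ∑ i, inner ℝ (ξ (ξ (e i) X) Y) (e i)
        + ∑ i, inner ℝ (ξ (ξ X (e i)) Y) (e i)
        - ∑ i, inner ℝ (ξ (ξ (e i) Y) X) (e i)
        + ∑ i, inner ℝ (ξ (ξ Y (e i)) X) (e i)
        + ∑ i, inner ℝ (ξ (ξ (e i) (J x X)) (J x Y)) (e i)
        - ∑ i, inner ℝ (ξ (ξ (J x X) (e i)) (J x Y)) (e i)
        + ∑ i, inner ℝ (ξ (ξ (e i) (J x Y)) (J x X)) (e i)
        - ∑ i, inner ℝ (ξ (ξ (J x Y) (e i)) (J x X)) (e i)) := by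
  intro ξ DJξ Dξ Ric RicS H AH
  have hdiff := ricciStar_sub_ricci_eq_sum_covDerivTensor_minimalUnitaryConnection J e
  have hstar := antiHermitianPart_ricciStar_swap J X Y
  have hricci := antiHermitianPart_ricci_comm J X Y
  have hξ := sum_inner_intrinsicTorsion_intrinsicTorsion_comm J e
  simp only [antiHermitianPart] at hstar hricci
  refine ⟨ricciStar_sub_ricci_eq_sum_covDerivTensor_leviCivita J e X Y, hdiff X Y, ?_, ?_, ?_⟩
  · simp only [H, hermitianPart]
    linear_combination (hdiff X Y + hdiff (J x X) (J x Y)) / 2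
  · simp only [AH, antiHermitianPart]
    linear_combination
      (hdiff X Y - hdiff Y X - hdiff (J x X) (J x Y) + hdiff (J x Y) (J x X)) / 2
        + hstar - hricci + hξ X Y - hξ (J x X) (J x Y)
  · simp only [AH, antiHermitianPart]
    linear_combination
      (-hdiff X Y - hdiff Y X + hdiff (J x X) (J x Y) + hdiff (J x Y) (J x X)) / 2
        + hstar - hricci

theorem lemma3p1 (n : ℕ) (hn : 2 ≤ n)
    {M : Type*} [TopologicalSpace M] [T2Space M] [SecondCountableTopology M]
    [ChartedSpace (EuclideanSpace ℝ (Fin (2 * n))) M] [IsManifold (𝓡 (2 * n)) ∞ M]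
    [RiemannianBundle (fun x : M ↦ TangentSpace (𝓡 (2 * n)) x)]
    [IsContMDiffRiemannianBundle (𝓡 (2 * n)) ∞ (EuclideanSpace ℝ (Fin (2 * n)))
      (fun x : M ↦ TangentSpace (𝓡 (2 * n)) x)]
    (J : AlmostHermitian.OrthogonalAlmostComplexStructure (𝓡 (2 * n)) M)
    (x : M) (e : OrthonormalBasis (Fin (2 * n)) ℝ (TangentSpace (𝓡 (2 * n)) x))
    (X Y : TangentSpace (𝓡 (2 * n)) x) :
    -- `ξ a b = ξ_a b`, `DJξ v a b = (∇_v (Jξ))_a b`, `Dξ v a b = (∇̃_v ξ)_a b`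
    let ξ := AlmostHermitian.intrinsicTorsion J x
    let DJξ := AlmostHermitian.covDerivTensor (AlmostHermitian.leviCivita (𝓡 (2 * n)) M)
      (AlmostHermitian.complexIntrinsicTorsion J) x
    let Dξ := AlmostHermitian.covDerivTensor (AlmostHermitian.minimalUnitaryConnection J)
      (AlmostHermitian.intrinsicTorsion J) x
    let Ric := AlmostHermitian.ricci x
    let RicS := AlmostHermitian.ricciStar J x
    let H := AlmostHermitian.hermitianPart J (x := x)
    let AH := AlmostHermitian.antiHermitianPart J (x := x)
    -- the difference of the two Ricci curvatures, through `∇` and through `∇̃`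
    (RicS X Y - Ric X Y
      = 2 * ∑ i, inner ℝ (DJξ (e i) X (J x Y)) (e i)
        - 2 * ∑ i, inner ℝ (DJξ X (e i) (J x Y)) (e i)) ∧
    (RicS X Y - Ric X Y
      = 2 * ∑ i, inner ℝ (Dξ (e i) X Y) (e i)
        - 2 * ∑ i, inner ℝ (Dξ X (e i) Y) (e i)
        + 2 * ∑ i, inner ℝ (ξ (ξ (e i) X) Y) (e i)
        - 2 * ∑ i, inner ℝ (ξ (ξ X (e i)) Y) (e i)) ∧
    -- the Hermitian part of the difference
    (H RicS X Y - H Ric X Y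
      = ∑ i, inner ℝ (Dξ (e i) X Y) (e i)
        - ∑ i, inner ℝ (Dξ X (e i) Y) (e i)
        + ∑ i, inner ℝ (Dξ (e i) (J x X) (J x Y)) (e i)
        - ∑ i, inner ℝ (Dξ (J x X) (e i) (J x Y)) (e i)
        + ∑ i, inner ℝ (ξ (ξ (e i) X) Y) (e i)
        - ∑ i, inner ℝ (ξ (ξ X (e i)) Y) (e i)
        + ∑ i, inner ℝ (ξ (ξ (e i) (J x X)) (J x Y)) (e i)
        - ∑ i, inner ℝ (ξ (ξ (J x X) (e i)) (J x Y)) (e i)) ∧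
    -- the anti-Hermitian part of the `*`-Ricci curvature
    (2 * AH RicS X Y
      = ∑ i, inner ℝ (Dξ (e i) X Y) (e i)
        - ∑ i, inner ℝ (Dξ (e i) Y X) (e i)
        - ∑ i, inner ℝ (Dξ (e i) (J x X) (J x Y)) (e i)
        + ∑ i, inner ℝ (Dξ (e i) (J x Y) (J x X)) (e i)
        - ∑ i, inner ℝ (Dξ X (e i) Y) (e i)
        + ∑ i, inner ℝ (Dξ Y (e i) X) (e i)
        + ∑ i, inner ℝ (Dξ (J x X) (e i) (J x Y)) (e i)
        - ∑ i, inner ℝ (Dξ (J x Y) (e i) (J x X)) (e i)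
        - ∑ i, inner ℝ (ξ (ξ X (e i)) Y) (e i)
        + ∑ i, inner ℝ (ξ (ξ Y (e i)) X) (e i)
        + ∑ i, inner ℝ (ξ (ξ (J x X) (e i)) (J x Y)) (e i)
        - ∑ i, inner ℝ (ξ (ξ (J x Y) (e i)) (J x X)) (e i)) ∧
    -- the anti-Hermitian part of the Ricci curvature
    (2 * AH Ric X Y
      = - ∑ i, inner ℝ (Dξ (e i) X Y) (e i)
        + ∑ i, inner ℝ (Dξ X (e i) Y) (e i)
        - ∑ i, inner ℝ (Dξ (e i) Y X) (e i)
        + ∑ i, inner ℝ (Dξ Y (e i) X) (e i)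
        + ∑ i, inner ℝ (Dξ (e i) (J x X) (J x Y)) (e i)
        - ∑ i, inner ℝ (Dξ (J x X) (e i) (J x Y)) (e i)
        + ∑ i, inner ℝ (Dξ (e i) (J x Y) (J x X)) (e i)
        - ∑ i, inner ℝ (Dξ (J x Y) (e i) (J x X)) (e i)
        - ∑ i, inner ℝ (ξ (ξ (e i) X) Y) (e i)
        + ∑ i, inner ℝ (ξ (ξ X (e i)) Y) (e i)
        - ∑ i, inner ℝ (ξ (ξ (e i) Y) X) (e i)
        + ∑ i, inner ℝ (ξ (ξ Y (e i)) X) (e i)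
        + ∑ i, inner ℝ (ξ (ξ (e i) (J x X)) (J x Y)) (e i)
        - ∑ i, inner ℝ (ξ (ξ (J x X) (e i)) (J x Y)) (e i)
        + ∑ i, inner ℝ (ξ (ξ (e i) (J x Y)) (J x X)) (e i)
        - ∑ i, inner ℝ (ξ (ξ (J x Y) (e i)) (J x X)) (e i)) :=
  lemma3p1_general J e X Y
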